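/- Let $J\subseteq\mathbb R$ be an open interval and $\mathbf x=(x,y,z)\colon J\to\mathbb R^3$ a smooth curve parametrized by arc length $s$, with Euclidean curvature $\kappa>0$ and torsion $\tau$, where for a general parameter $$\eta=|\mathbf x_s|,\qquad \kappa=\frac{|\mathbf x_s\times\mathbf x_{ss}|}{|\mathbf x_s|^3},\qquad \tau=\frac{\mathbf x_{sss}\cdot(\mathbf x_s\times\mathbf x_{ss})}{|\mathbf x_s\times\mathbf x_{ss}|^2}.$$ Let $L=L(\kappa,\tau,\kappa_1,\tau_1,\dots,\kappa_n,\tau_n)$, $\kappa_m=D_s^m\kappa$, $\tau_m=D_s^m\tau$, be a smooth function on an open set containing the values of these arguments along the curve, and put $\mathsf E^\kappa=\sum_m(-1)^mD_s^m\frac{\partial L}{\partial\kappa_m}$, $\mathsf E^\tau=\sum_m(-1)^mD_s^m\frac{\partial L}{\partial\tau_m}$. For a function $\lambda(s)$ put $$\mathsf E^x=\kappa_s\mathsf E^\kappa+\tau_s\mathsf E^\tau-D_s(2\tau\mathsf E^\tau)+\lambda_s,$$ $$\mathsf E^y=D_s^2\mathsf E^\kappa+\tfrac{2\tau}{\kappa}D_s^2\mathsf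 E^\tau+\Big(\tfrac{\tau_s}{\kappa}-\tfrac{2\tau\kappa_s}{\kappa^2}\Big)D_s\mathsf E^\tau+(\kappa^2-\tau^2)\mathsf E^\kappa+\lambda\kappa,$$ $$\mathsf E^z=-\tfrac1\kappa D_s^3\mathsf E^\tau+\tfrac{2\kappa_s}{\kappa^2}D_s^2\mathsf E^\tau+\Big(\tfrac{\kappa_{ss}}{\kappa^2}+\tfrac{\tau^2}{\kappa}-\tfrac{2\kappa_s^2}{\kappa^3}-\kappa\Big)D_s\mathsf E^\tau-\kappa_s\mathsf E^\tau+2\tau D_s\mathsf E^\kappa+\tau_s\mathsf E^\kappa,$$ $$\lambda_0=2\tau\mathsf E^\tau-L+\sum_{m\ge1}\sum_{i=0}^{m-1}(-1)^i\Big(D_s^i\frac{\partial L}{\partial\kappa_m}\,\kappa_{m-i}+D_s^i\frac{\partial L}{\partial\tau_m}\,\tau_{m-i}\Big).$$ Let $\rho_{FS}=(\mathbf x_s\mid \mathbf x_{ss}/\kappa\mid \mathbf x_s\times\mathbf x_{ss}/\kappa)$, $D=\mathrm{diag}(1,-1,1)$, $X=\begin{pmatrix}0&-z&y\\z&0&-x\\-y&x&0\end{pmatrix}$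 and $$\mathcal Ad(\rho)^{-1}=\begin{pmatrix}\rho_{FS}&0\\DX\rho_{FS}&D\rho_{FS}D\end{pmatrix},\qquad \boldsymbol\upsilon_\lambda=\begin{pmatrix}\tau\mathsf E^\tau-\kappa\mathsf E^\kappa-\lambda\\-D_s\mathsf E^\kappa-\frac\tau\kappa D_s\mathsf E^\tau\\\frac1\kappa D_s^2\mathsf E^\tau-\frac{\kappa_s}{\kappa^2}D_s\mathsf E^\tau+\kappa\mathsf E^\tau-\tau\mathsf E^\kappa\\\mathsf E^\tau\\-\frac1\kappa D_s\mathsf E^\tau\\\mathsf E^\kappa\end{pmatrix}.$$ "Extremal" means that the first variation along $\mathbf x+\varepsilon\mathbf v$ vanishes for all smooth $\mathbf v$ with compact support in $J$. Then: 1. (Euler–Lagrange equations.) For every smooth $\mu$ on $J$, with $\lambda=\mu+2\tau\mathsf E^\tau$, the first variation of $\int[L(\kappa,\tau,\kappa_s,\tau_s,\dots)-\mu(s)(\eta-1)]\,ds$ at $\mathbf x$ along $\mathbf v$ (the parameter $s$ being kept fixed) is $\int(\mathsf E^xI^x+\mathsf E^yI^y+\mathsf E^zI^z)\,ds$, where $I^x,I^y,I^z$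 are the components of $\mathbf v$ in the Frenet–Serret frame. Hence $\mathbf x$ is an extremal with multiplier $\mu$ if and only if $\mathsf E^x=\mathsf E^y=\mathsf E^z=0$ on $J$. 2. (Multiplier.) A function $\lambda$ on $J$ is differentiable and satisfies $\mathsf E^x=0$ if and only if $\lambda=\lambda_0+C$ for a constant $C$. The curve $\mathbf x$ is an extremal of the unconstrained, parametrization-independent functional $\int L(\kappa,\tau,\kappa_s,\tau_s,\dots)\,ds$ ($s$ the arc length of the varied curve) if and only if $\mathsf E^y=\mathsf E^z=0$ with $\lambda=\lambda_0$, that is, with $C=0$. 3. (Adjoint representation.) On $J$, $\rho_{FS}\in SO(3)$, and $\mathcal Ad(\rho)^{-1}$ is the matrix of the Adjoint representation at the frame $p\mapsto\rho_{FS}\,p+\mathbf x$ with respect to the generators $\zeta_1,\dots,\zeta_6=\partial_x,\ \partial_y,\ \partial_z,\ y\partial_z-z\partial_y,\ x\partial_z-z\partial_x,\ x\partial_y-y\partial_x$, that is, $\zeta_j(\rho_{FS}\,p+\mathbf x)=\rho_{FS}\sum_k(\mathcal Ad(\rho)^{-1})_{jk}\,\zeta_k(p)$ for all $p\in\mathbb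 R^3$. 4. (Noether currents.) For $\mu$ and $\lambda$ as in 1, the components of $\mathcal Ad(\rho)^{-1}\boldsymbol\upsilon_\lambda$ are the Noether currents of the six generators: for every smooth $\varphi$ with compact support in $J$, the first variation of the functional in 1 along $\varphi\,\zeta_j(\mathbf x)$ is $\int\varphi_s\,(\mathcal Ad(\rho)^{-1}\boldsymbol\upsilon_\lambda)_j\,ds$. 5. (Conservation laws.) If $\lambda$ is differentiable and $\mathsf E^x=\mathsf E^y=\mathsf E^z=0$ on $J$, then $\mathcal Ad(\rho)^{-1}\boldsymbol\upsilon_\lambda=\mathbf c$ on $J$ for a constant vector $\mathbf c=(\mathbf c_1,\mathbf c_2)\in\mathbb R^6$. In particular this holds for $\lambda=\lambda_0$ whenever $\mathsf E^y=\mathsf E^z=0$ with $\lambda=\lambda_0$. -/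

import Mathlib

open scoped Matrix ContDiff

noncomputable section

namespace SE3Variational

/-! ### Space curves

Vectors of Euclidean three-space are written in coordinates, as functions `Fin 3 → ℝ`; lengths
are always Euclidean (`len`), the norm instance on the function space is not used. -/

/-- Euclidean length of a vector. -/
def len (u : Fin 3 → ℝ) : ℝ := Real.sqrt (u ⬝ᵥ u)

/-- The speed `η = |x_s|`. -/
def speed (x : ℝ → Fin 3 → ℝ) (s : ℝ) : ℝ := len (deriv x s)

/-- Euclidean curvature `|x_s × x_ss| / |x_s|³` (for an arbitrary parametrization). -/
def curvature (x : ℝ → Fin 3 → ℝ) (s : ℝ) : ℝ :=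
  len (deriv x s ⨯₃ iteratedDeriv 2 x s) / len (deriv x s) ^ 3

/-- Torsion `x_sss · (x_s × x_ss) / |x_s × x_ss|²` (for an arbitrary parametrization). -/
def torsion (x : ℝ → Fin 3 → ℝ) (s : ℝ) : ℝ :=
  (iteratedDeriv 3 x s ⬝ᵥ (deriv x s ⨯₃ iteratedDeriv 2 x s)) /
    len (deriv x s ⨯₃ iteratedDeriv 2 x s) ^ 2

/-- Frenet–Serret tangent `x_s` of a curve parametrized by arc length. -/
def tangent (x : ℝ → Fin 3 → ℝ) (s : ℝ) : Fin 3 → ℝ := deriv x s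

/-- Frenet–Serret normal `x_ss / κ` of a curve parametrized by arc length. -/
def normal (x : ℝ → Fin 3 → ℝ) (s : ℝ) : Fin 3 → ℝ :=
  (curvature x s)⁻¹ • iteratedDeriv 2 x s

/-- Frenet–Serret binormal `x_s × x_ss / κ` of a curve parametrized by arc length. -/
def binormal (x : ℝ → Fin 3 → ℝ) (s : ℝ) : Fin 3 → ℝ :=
  (curvature x s)⁻¹ • (deriv x s ⨯₃ iteratedDeriv 2 x s)

/-- The Frenet–Serret matrix, with columns tangent, normal, binormal. -/
def frenet (x : ℝ → Fin 3 → ℝ) (s : ℝ) : Matrix (Fin 3) (Fin 3) ℝ :=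
  Matrix.of fun i j => ![tangent x s i, normal x s i, binormal x s i] j

/-! ### The adjoint representation -/

/-- The generators of the action of `SE(3)` on space, as vector fields:
`∂_x, ∂_y, ∂_z` and `y∂_z - z∂_y, x∂_z - z∂_x, x∂_y - y∂_x`. -/
def generator : Fin 3 ⊕ Fin 3 → (Fin 3 → ℝ) → Fin 3 → ℝ
  | Sum.inl i, _ => Pi.single i 1
  | Sum.inr i, p => ![![0, -p 2, p 1], ![-p 2, 0, p 0], ![-p 1, p 0, 0]] i

/-- `D = diag(1, -1, 1)`. -/
def matD : Matrix (Fin 3) (Fin 3) ℝ := Matrix.diagonal ![1, -1, 1]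

/-- The skew matrix `X` of a point `(x, y, z)`. -/
def matX (p : Fin 3 → ℝ) : Matrix (Fin 3) (Fin 3) ℝ :=
  !![0, -p 2, p 1; p 2, 0, -p 0; -p 1, p 0, 0]

/-- The block matrix `[[ρ, 0], [D X ρ, D ρ D]]`, with `ρ` the Frenet–Serret matrix. -/
def adFrame (x : ℝ → Fin 3 → ℝ) (s : ℝ) : Matrix (Fin 3 ⊕ Fin 3) (Fin 3 ⊕ Fin 3) ℝ :=
  Matrix.fromBlocks (frenet x s) 0
    (matD * matX (x s) * frenet x s) (matD * frenet x s * matD)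

/-! ### Lagrangians in `κ, τ` and their derivatives up to order `n`

A point `(a, b)` of `Jets n` stands for `κ_m = a m`, `τ_m = b m`, `0 ≤ m ≤ n`. -/

/-- The space of jets `((κ, κ_s, …, κ_n), (τ, τ_s, …, τ_n))`. -/
abbrev Jets (n : ℕ) : Type := (Fin (n + 1) → ℝ) × (Fin (n + 1) → ℝ)

/-- The jet at `s` of a pair of functions `κ, τ` of the parameter. -/
def jet (n : ℕ) (κ τ : ℝ → ℝ) (s : ℝ) : Jets n :=
  (fun m => iteratedDeriv m κ s, fun m => iteratedDeriv m τ s)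

section Euler

variable {n : ℕ} (L : Jets n → ℝ) (κ τ : ℝ → ℝ)

/-- `∂L/∂κ_m` along `(κ, τ)`. -/
def dLκ (m : Fin (n + 1)) (s : ℝ) : ℝ := fderiv ℝ L (jet n κ τ s) (Pi.single m 1, 0)

/-- `∂L/∂τ_m` along `(κ, τ)`. -/
def dLτ (m : Fin (n + 1)) (s : ℝ) : ℝ := fderiv ℝ L (jet n κ τ s) (0, Pi.single m 1)

/-- Euler operator `E^κ(L) = ∑ (-1)^m D_s^m (∂L/∂κ_m)` along `(κ, τ)`. -/
def eulerκ (s : ℝ) : ℝ :=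
  ∑ m : Fin (n + 1), (-1 : ℝ) ^ (m : ℕ) * iteratedDeriv m (dLκ L κ τ m) s

/-- Euler operator `E^τ(L) = ∑ (-1)^m D_s^m (∂L/∂τ_m)` along `(κ, τ)`. -/
def eulerτ (s : ℝ) : ℝ :=
  ∑ m : Fin (n + 1), (-1 : ℝ) ^ (m : ℕ) * iteratedDeriv m (dLτ L κ τ m) s

/-- The explicit Lagrange multiplier
`2τE^τ(L) - L + ∑_m ∑_{i<m} (-1)^i D_s^i(∂L/∂κ_m) κ_{m-i}
  + ∑_m ∑_{i<m} (-1)^i D_s^i(∂L/∂τ_m) τ_{m-i}`. -/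
def multiplier (s : ℝ) : ℝ :=
  2 * τ s * eulerτ L κ τ s - L (jet n κ τ s)
    + ∑ m : Fin (n + 1), ∑ i ∈ Finset.range m,
        (-1 : ℝ) ^ i * iteratedDeriv i (dLκ L κ τ m) s * iteratedDeriv ((m : ℕ) - i) κ s
    + ∑ m : Fin (n + 1), ∑ i ∈ Finset.range m,
        (-1 : ℝ) ^ i * iteratedDeriv i (dLτ L κ τ m) s * iteratedDeriv ((m : ℕ) - i) τ s

/-- `E^x(L) = κ_s E^κ + τ_s E^τ - D_s(2τE^τ) + λ_s`. -/
def elX (lam : ℝ → ℝ) (s : ℝ) : ℝ :=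
  deriv κ s * eulerκ L κ τ s + deriv τ s * eulerτ L κ τ s
    - deriv (fun r => 2 * τ r * eulerτ L κ τ r) s + deriv lam s

/-- `E^y(L) = D_s²E^κ + (2τ/κ) D_s²E^τ + (τ_s/κ - 2τκ_s/κ²) D_sE^τ + (κ² - τ²)E^κ + λκ`. -/
def elY (lam : ℝ → ℝ) (s : ℝ) : ℝ :=
  iteratedDeriv 2 (eulerκ L κ τ) s
    + 2 * τ s / κ s * iteratedDeriv 2 (eulerτ L κ τ) s
    + (deriv τ s / κ s - 2 * τ s * deriv κ s / κ s ^ 2) * deriv (eulerτ L κ τ) s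
    + (κ s ^ 2 - τ s ^ 2) * eulerκ L κ τ s
    + lam s * κ s

/-- `E^z(L) = -(1/κ) D_s³E^τ + (2κ_s/κ²) D_s²E^τ + (κ_ss/κ² + τ²/κ - 2κ_s²/κ³ - κ) D_sE^τ
  - κ_s E^τ + 2τ D_sE^κ + τ_s E^κ`. -/
def elZ (s : ℝ) : ℝ :=
  -(1 / κ s) * iteratedDeriv 3 (eulerτ L κ τ) s
    + 2 * deriv κ s / κ s ^ 2 * iteratedDeriv 2 (eulerτ L κ τ) s
    + (iteratedDeriv 2 κ s / κ s ^ 2 + τ s ^ 2 / κ s - 2 * deriv κ s ^ 2 / κ s ^ 3 - κ s)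
        * deriv (eulerτ L κ τ) s
    - deriv κ s * eulerτ L κ τ s
    + 2 * τ s * deriv (eulerκ L κ τ) s
    + deriv τ s * eulerκ L κ τ s

/-- `κ, τ, λ` solve the invariantized Euler–Lagrange equations on `J`. -/
def SolvesEL (J : Set ℝ) (lam : ℝ → ℝ) : Prop :=
  DifferentiableOn ℝ lam J ∧
    ∀ s ∈ J, elX L κ τ lam s = 0 ∧ elY L κ τ lam s = 0 ∧ elZ L κ τ s = 0

/-- The vector of invariants `υ(I)`. -/
def upsilon (lam : ℝ → ℝ) (s : ℝ) : Fin 3 ⊕ Fin 3 → ℝ :=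
  Sum.elim
    ![τ s * eulerτ L κ τ s - κ s * eulerκ L κ τ s - lam s,
      -deriv (eulerκ L κ τ) s - τ s / κ s * deriv (eulerτ L κ τ) s,
      1 / κ s * iteratedDeriv 2 (eulerτ L κ τ) s
        - deriv κ s / κ s ^ 2 * deriv (eulerτ L κ τ) s
        + κ s * eulerτ L κ τ s - τ s * eulerκ L κ τ s]
    ![eulerτ L κ τ s,
      -(1 / κ s) * deriv (eulerτ L κ τ) s,
      eulerκ L κ τ s]

end Euler

/-! ### Variational problems -/

section Variation

variable {n : ℕ} (L : Jets n → ℝ)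

/-- The functional `∫_c^d [L(κ, τ, κ_s, τ_s, …) - μ(s)(η - 1)] ds` of a curve `s ↦ x(s)`: the
parameter `s` is kept fixed and `η = 1` is imposed by the multiplier `μ`. -/
def constrainedAction (μ : ℝ → ℝ) (c d : ℝ) (x : ℝ → Fin 3 → ℝ) : ℝ :=
  ∫ s in c..d, (L (jet n (curvature x) (torsion x) s) - μ s * (speed x s - 1))

/-- Differentiation with respect to arc length along a curve with arbitrary parameter. -/
def arcDeriv (x : ℝ → Fin 3 → ℝ) (f : ℝ → ℝ) : ℝ → ℝ := fun p => deriv f p / speed x p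

/-- The jet of curvature and torsion with respect to arc length. -/
def arcJet (n : ℕ) (x : ℝ → Fin 3 → ℝ) (p : ℝ) : Jets n :=
  (fun m => (arcDeriv x)^[m] (curvature x) p, fun m => (arcDeriv x)^[m] (torsion x) p)

/-- The parametrization-independent functional `∫ L(κ, τ, κ_s, τ_s, …) ds`, where `s` is the arc
length of the curve and the curve is given with an arbitrary parameter `p`. -/
def arcAction (c d : ℝ) (x : ℝ → Fin 3 → ℝ) : ℝ :=
  ∫ p in c..d, L (arcJet n x p) * speed x p

/-- `x` is an extremal on `J` of a functional given on each `[c, d] ⊆ J`: the first variation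
vanishes along every smooth variation supported inside `(c, d)`. -/
def IsExtremal (A : ℝ → ℝ → (ℝ → Fin 3 → ℝ) → ℝ) (J : Set ℝ) (x : ℝ → Fin 3 → ℝ) : Prop :=
  ∀ c d : ℝ, c < d → Set.Icc c d ⊆ J →
    ∀ v : ℝ → Fin 3 → ℝ, ContDiff ℝ ∞ v → tsupport v ⊆ Set.Ioo c d →
      HasDerivAt (fun ε : ℝ => A c d (fun s => x s + ε • v s)) 0 0

end Variation

end SE3Variational

end

open SE3Variational
open scoped Matrix ContDiff

namespace SE3Variational

open Set Filter Topology

/-! ### Smooth functions on open sets of the line and of the plane -/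

section Line

variable {E : Type*} [NormedAddCommGroup E] [NormedSpace ℝ E] {J : Set ℝ}

/-! Everything is read off from two vectors along the curve, with T, N, B the Frenet–Serret frame:
the momentum P, whose frame coordinates are the first three entries of `upsilon`, and the spin S,
which carries the last three. The whole theorem rests on three facts about them.

First, the first variation of either functional along v is the integral of P · v_s. To treat both at
once, the higher jets of the varied curvature and torsion are produced by iterating ∂_s / W, with W
= 1 for the constrained functional and W = η for the arc-length functional. Write e for ∂W/∂ε at ε =
0. The variations a_m of the m-th derivatives then obey a_{m+1} = D_s a_m - e κ_{m+1}, and likewise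
for τ. Integration by parts turns ∑ (∂L/∂κ_m) a_m, with its τ counterpart, into E^κ a_0 + E^τ b_0
minus e times the double sums in λ₀ (`IsRegularAlong.isTotalDeriv_prolongation`). For W = 1 one has
e = 0, and the constraint term supplies μ = λ - 2τE^τ. For W = η one has e = v_s · T; varying the
length element adds e L, which cancels the L in those sums and leaves exactly λ = λ₀, so the
constant C is forced to vanish. Inserting the variations of κ and τ and integrating by parts again
leaves P · v_s (`isTotalDeriv_momentum`, `hasDerivAt_action`).

Second, the Frenet–Serret equations give P_s = -(E^x T + E^y N + E^z B) (`hasDerivAt_momentum`). One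
more integration by parts and the fundamental lemma yield the Euler–Lagrange equations
(`isExtremal_iff`).

Third, S_s = -T × P (`hasDerivAt_spin`), hence (x × P + S)_s = x × P_s. The matrix `adFrame` sends
`upsilon` to the pair P, D(x × P + S), so both blocks are constant on solutions. Inserting φ ζ_j(x)
for v identifies the same components as Noether currents.

All boundary terms vanish because a variation supported in the open interval (c, d) is zero near c
and d. -/

theorem smoothOn_deriv (hJ : IsOpen J) {f : ℝ → E} (hf : ContDiffOn ℝ ∞ f J) :
    ContDiffOn ℝ ∞ (deriv f) J :=
  hf.deriv_of_isOpen hJ (by simp)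

theorem smoothOn_iteratedDeriv (hJ : IsOpen J) {f : ℝ → E} (hf : ContDiffOn ℝ ∞ f J) (m : ℕ) :
    ContDiffOn ℝ ∞ (iteratedDeriv m f) J := by
  induction m with
  | zero => simpa using hf
  | succ m ih => rw [iteratedDeriv_succ]; exact smoothOn_deriv hJ ih

theorem hasDerivAt_of_smoothOn (hJ : IsOpen J) {f : ℝ → E} (hf : ContDiffOn ℝ ∞ f J) {s : ℝ}
    (hs : s ∈ J) : HasDerivAt f (deriv f s) s :=
  ((hf.differentiableOn (by simp)).differentiableAt (hJ.mem_nhds hs)).hasDerivAt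

theorem hasDerivAt_iteratedDeriv (hJ : IsOpen J) {f : ℝ → E} (hf : ContDiffOn ℝ ∞ f J) (m : ℕ)
    {s : ℝ} (hs : s ∈ J) : HasDerivAt (iteratedDeriv m f) (iteratedDeriv (m + 1) f s) s := by
  rw [iteratedDeriv_succ]
  exact hasDerivAt_of_smoothOn hJ (smoothOn_iteratedDeriv hJ hf m) hs

theorem eqOn_deriv (hJ : IsOpen J) {f g : ℝ → E} (h : EqOn f g J) : EqOn (deriv f) (deriv g) J :=
  fun _ hs => (h.eventuallyEq_of_mem (hJ.mem_nhds hs)).deriv_eq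

theorem eventuallyEq_zero_deriv {f : ℝ → E} {c : ℝ} (h : f =ᶠ[𝓝 c] 0) : deriv f =ᶠ[𝓝 c] 0 := by
  simpa using! h.deriv

theorem eventuallyEq_zero_iteratedDeriv {f : ℝ → E} {c : ℝ} (h : f =ᶠ[𝓝 c] 0) (m : ℕ) :
    iteratedDeriv m f =ᶠ[𝓝 c] 0 := by
  induction m with
  | zero => simpa using h
  | succ m ih => rw [iteratedDeriv_succ]; exact eventuallyEq_zero_deriv ih

end Line

section Vectors

theorem _root_.HasDerivAt.dotProduct {f g : ℝ → Fin 3 → ℝ} {f' g' : Fin 3 → ℝ} {s : ℝ}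
    (hf : HasDerivAt f f' s) (hg : HasDerivAt g g' s) :
    HasDerivAt (fun r => f r ⬝ᵥ g r) (f' ⬝ᵥ g s + f s ⬝ᵥ g') s := by
  rw [hasDerivAt_pi] at hf hg
  simp only [_root_.dotProduct, Fin.sum_univ_three]
  exact ((((hf 0).mul (hg 0)).add ((hf 1).mul (hg 1))).add ((hf 2).mul (hg 2))).congr_deriv
    (by ring)

theorem _root_.HasDerivAt.crossProduct {f g : ℝ → Fin 3 → ℝ} {f' g' : Fin 3 → ℝ} {s : ℝ}
    (hf : HasDerivAt f f' s) (hg : HasDerivAt g g' s) :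
    HasDerivAt (fun r => f r ⨯₃ g r) (f' ⨯₃ g s + f s ⨯₃ g') s := by
  rw [hasDerivAt_pi] at hf hg ⊢
  intro i
  simp only [cross_apply]
  fin_cases i
  · exact (((hf 1).mul (hg 2)).sub ((hf 2).mul (hg 1))).congr_deriv (by simp; ring)
  · exact (((hf 2).mul (hg 0)).sub ((hf 0).mul (hg 2))).congr_deriv (by simp; ring)
  · exact (((hf 0).mul (hg 1)).sub ((hf 1).mul (hg 0))).congr_deriv (by simp; ring)

variable {E : Type*} [NormedAddCommGroup E] [NormedSpace ℝ E] {U : Set E}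

theorem _root_.ContDiffOn.dotProduct {f g : E → Fin 3 → ℝ} (hf : ContDiffOn ℝ ∞ f U)
    (hg : ContDiffOn ℝ ∞ g U) : ContDiffOn ℝ ∞ (fun r => f r ⬝ᵥ g r) U := by
  rw [contDiffOn_pi] at hf hg
  simp only [_root_.dotProduct]
  exact ContDiffOn.sum fun i _ => (hf i).mul (hg i)

theorem _root_.ContDiffOn.crossProduct {f g : E → Fin 3 → ℝ} (hf : ContDiffOn ℝ ∞ f U)
    (hg : ContDiffOn ℝ ∞ g U) : ContDiffOn ℝ ∞ (fun r => f r ⨯₃ g r) U := by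
  rw [contDiffOn_pi] at hf hg ⊢
  intro i
  simp only [cross_apply]
  fin_cases i
  · exact ((hf 1).mul (hg 2)).sub ((hf 2).mul (hg 1))
  · exact ((hf 2).mul (hg 0)).sub ((hf 0).mul (hg 2))
  · exact ((hf 0).mul (hg 1)).sub ((hf 1).mul (hg 0))

theorem dotProduct_self_pos {u : Fin 3 → ℝ} (hu : u ≠ 0) : 0 < u ⬝ᵥ u := by
  have h : 0 ≤ u ⬝ᵥ u := by
    rw [dotProduct]; exact Finset.sum_nonneg fun i _ => mul_self_nonneg (u i)
  exact lt_of_le_of_ne h fun h0 => hu (dotProduct_self_eq_zero.1 h0.symm)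

theorem len_pos {u : Fin 3 → ℝ} (hu : u ≠ 0) : 0 < len u :=
  Real.sqrt_pos.2 (dotProduct_self_pos hu)

theorem len_sq (u : Fin 3 → ℝ) : len u ^ 2 = u ⬝ᵥ u :=
  Real.sq_sqrt (by rw [dotProduct]; exact Finset.sum_nonneg fun i _ => mul_self_nonneg (u i))

theorem smoothOn_len {f : E → Fin 3 → ℝ} (hf : ContDiffOn ℝ ∞ f U) (h : ∀ q ∈ U, f q ≠ 0) :
    ContDiffOn ℝ ∞ (fun q => len (f q)) U :=
  (hf.dotProduct hf).sqrt fun q hq => (dotProduct_self_pos (h q hq)).ne'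

theorem hasDerivAt_len {f : ℝ → Fin 3 → ℝ} {f' : Fin 3 → ℝ} {s : ℝ} (hf : HasDerivAt f f' s)
    (h : f s ≠ 0) : HasDerivAt (fun r => len (f r)) (f' ⬝ᵥ f s / len (f s)) s := by
  refine ((hf.dotProduct hf).sqrt (dotProduct_self_pos h).ne').congr_deriv ?_
  rw [dotProduct_comm (f s) f', ← two_mul, mul_div_mul_left _ _ two_ne_zero]
  rfl

end Vectors

/-! ### Partial derivatives of functions of the variation parameter and the curve parameter -/

section Partial

variable {E : Type*} [NormedAddCommGroup E] [NormedSpace ℝ E]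

/-- Derivative in the second variable. -/
noncomputable def partialS (F : ℝ × ℝ → E) (q : ℝ × ℝ) : E := deriv (fun s => F (q.1, s)) q.2

/-- Derivative in the first variable. -/
noncomputable def partialE (F : ℝ × ℝ → E) (q : ℝ × ℝ) : E := deriv (fun ε => F (ε, q.2)) q.1

/-- Bridges one-variable derivatives of the slices and partial derivatives in the plane; it is how
joint smoothness in (ε, s) reaches the derivatives of the varied curves. -/
theorem iterate_partialS (F : ℝ × ℝ → E) (m : ℕ) (q : ℝ × ℝ) :
    partialS^[m] F q = iteratedDeriv m (fun s => F (q.1, s)) q.2 := by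
  induction m generalizing q with
  | zero => simp
  | succ m ih =>
    rw [Function.iterate_succ_apply', iteratedDeriv_succ, partialS]
    simp only [ih]

variable {U : Set (ℝ × ℝ)} {F : ℝ × ℝ → E}

theorem hasDerivAt_second (hU : IsOpen U) (hF : ContDiffOn ℝ ∞ F U) {q : ℝ × ℝ} (hq : q ∈ U) :
    HasDerivAt (fun s => F (q.1, s)) (fderiv ℝ F q (0, 1)) q.2 := by
  have h := ((hF.differentiableOn (by simp)).differentiableAt (hU.mem_nhds hq)).hasFDerivAt
  exact h.comp_hasDerivAt q.2 ((hasDerivAt_const q.2 q.1).prodMk (hasDerivAt_id q.2))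

theorem hasDerivAt_first (hU : IsOpen U) (hF : ContDiffOn ℝ ∞ F U) {q : ℝ × ℝ} (hq : q ∈ U) :
    HasDerivAt (fun ε => F (ε, q.2)) (fderiv ℝ F q (1, 0)) q.1 := by
  have h := ((hF.differentiableOn (by simp)).differentiableAt (hU.mem_nhds hq)).hasFDerivAt
  exact h.comp_hasDerivAt q.1 ((hasDerivAt_id q.1).prodMk (hasDerivAt_const q.1 q.2))

theorem partialS_eqOn (hU : IsOpen U) (hF : ContDiffOn ℝ ∞ F U) :
    EqOn (partialS F) (fun q => fderiv ℝ F q (0, 1)) U :=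
  fun _ hq => (hasDerivAt_second hU hF hq).deriv

theorem partialE_eqOn (hU : IsOpen U) (hF : ContDiffOn ℝ ∞ F U) :
    EqOn (partialE F) (fun q => fderiv ℝ F q (1, 0)) U :=
  fun _ hq => (hasDerivAt_first hU hF hq).deriv

theorem smoothOn_fderiv_apply (hU : IsOpen U) (hF : ContDiffOn ℝ ∞ F U) (w : ℝ × ℝ) :
    ContDiffOn ℝ ∞ (fun q => fderiv ℝ F q w) U :=
  (hF.fderiv_of_isOpen hU (by simp)).clm_apply contDiffOn_const

theorem smoothOn_partialS (hU : IsOpen U) (hF : ContDiffOn ℝ ∞ F U) :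
    ContDiffOn ℝ ∞ (partialS F) U :=
  (smoothOn_fderiv_apply hU hF _).congr (partialS_eqOn hU hF)

theorem smoothOn_partialE (hU : IsOpen U) (hF : ContDiffOn ℝ ∞ F U) :
    ContDiffOn ℝ ∞ (partialE F) U :=
  (smoothOn_fderiv_apply hU hF _).congr (partialE_eqOn hU hF)

theorem hasDerivAt_partialE (hU : IsOpen U) (hF : ContDiffOn ℝ ∞ F U) {q : ℝ × ℝ} (hq : q ∈ U) :
    HasDerivAt (fun ε => F (ε, q.2)) (partialE F q) q.1 := by
  rw [partialE_eqOn hU hF hq]; exact hasDerivAt_first hU hF hq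

theorem smoothOn_iterate_partialS (hU : IsOpen U) (hF : ContDiffOn ℝ ∞ F U) (m : ℕ) :
    ContDiffOn ℝ ∞ (partialS^[m] F) U := by
  induction m with
  | zero => exact hF
  | succ m ih => rw [Function.iterate_succ_apply']; exact smoothOn_partialS hU ih

theorem partialE_congr (hU : IsOpen U) {G : ℝ × ℝ → E} (h : EqOn F G U) :
    EqOn (partialE F) (partialE G) U := by
  intro q hq
  have hc : ContinuousAt (fun ε : ℝ => (ε, q.2)) q.1 := by fun_prop
  have h2 : ∀ᶠ ε in 𝓝 q.1, (ε, q.2) ∈ U := hc (hU.mem_nhds hq)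
  exact EventuallyEq.deriv_eq (h2.mono fun ε hε => h hε)

theorem partialS_congr (hU : IsOpen U) {G : ℝ × ℝ → E} (h : EqOn F G U) :
    EqOn (partialS F) (partialS G) U := by
  intro q hq
  have hc : ContinuousAt (fun s : ℝ => (q.1, s)) q.2 := by fun_prop
  have h2 : ∀ᶠ s in 𝓝 q.2, (q.1, s) ∈ U := hc (hU.mem_nhds hq)
  exact EventuallyEq.deriv_eq (h2.mono fun s hs => h hs)

/-- Symmetry of the second Fréchet derivative. -/
theorem partialE_partialS (hU : IsOpen U) (hF : ContDiffOn ℝ ∞ F U) :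
    EqOn (partialE (partialS F)) (partialS (partialE F)) U := by
  intro q hq
  rw [partialE_congr hU (partialS_eqOn hU hF) hq, partialS_congr hU (partialE_eqOn hU hF) hq,
    partialE_eqOn hU (smoothOn_fderiv_apply hU hF _) hq,
    partialS_eqOn hU (smoothOn_fderiv_apply hU hF _) hq]
  have hd : DifferentiableAt ℝ (fderiv ℝ F) q :=
    ((hF.fderiv_of_isOpen (m := ∞) hU (by simp)).differentiableOn (by simp)).differentiableAt
      (hU.mem_nhds hq)
  have hs : IsSymmSndFDerivAt ℝ F q :=
    (hF.contDiffAt (hU.mem_nhds hq)).isSymmSndFDerivAt (by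
      rw [minSmoothness_of_isRCLikeNormedField]; exact WithTop.coe_le_coe.2 (le_top (a := (2 : ℕ∞))))
  simp only [fderiv_clm_apply hd (differentiableAt_const _)]
  simpa using hs (1, 0) (0, 1)

/-- Differentiation under the integral sign over a compact interval. -/
theorem hasDerivAt_integral_of_smoothOn {F : ℝ × ℝ → ℝ} (hU : IsOpen U) (hF : ContDiffOn ℝ ∞ F U)
    {c d : ℝ} (hcd : c ≤ d) (hsub : ∀ s ∈ Icc c d, ((0 : ℝ), s) ∈ U) :
    HasDerivAt (fun ε => ∫ s in c..d, F (ε, s)) (∫ s in c..d, partialE F (0, s)) 0 := by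
  -- The segment {0} × [c, d] is compact in the open set U, so a full strip |ε| ≤ δ around it lies
  -- in U; on this compact strip the ε-derivative is bounded by a constant, which serves as the
  -- dominating function.
  obtain ⟨V, W, hV, -, h0V, hW, hVW⟩ := generalized_tube_lemma (isCompact_singleton (x := (0 : ℝ)))
    (isCompact_Icc (a := c) (b := d)) hU (by rintro ⟨ε, s⟩ ⟨rfl, hs⟩; exact hsub s hs)
  obtain ⟨δ, hδ, hδV⟩ := Metric.nhds_basis_closedBall.mem_iff.1 (hV.mem_nhds (h0V rfl))
  have hK : Metric.closedBall (0 : ℝ) δ ×ˢ Icc c d ⊆ U :=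
    (prod_mono hδV hW).trans hVW
  have hcont := (smoothOn_partialE hU hF).continuousOn.mono hK
  obtain ⟨C, hC⟩ := ((isCompact_closedBall (0 : ℝ) δ).prod isCompact_Icc).exists_bound_of_continuousOn
    hcont
  have hι : uIoc c d ⊆ Icc c d := by rw [uIoc_of_le hcd]; exact Ioc_subset_Icc_self
  have slice : ∀ {G : ℝ × ℝ → ℝ}, ContinuousOn G U → ∀ ε ∈ Metric.closedBall (0 : ℝ) δ,
      ContinuousOn (fun s => G (ε, s)) (Icc c d) := fun hG ε hε =>
    hG.comp (by fun_prop) fun s hs => hK ⟨hε, hs⟩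
  refine (intervalIntegral.hasDerivAt_integral_of_dominated_loc_of_deriv_le
    (F := fun ε s => F (ε, s)) (F' := fun ε s => partialE F (ε, s)) (bound := fun _ => C)
    (Metric.closedBall_mem_nhds 0 hδ) ?_ ?_ ?_ ?_ intervalIntegrable_const ?_).2
  · filter_upwards [Metric.closedBall_mem_nhds (0 : ℝ) hδ] with ε hε
    exact ((slice hF.continuousOn ε hε).aestronglyMeasurable measurableSet_Icc).mono_measure
      (MeasureTheory.Measure.restrict_mono hι le_rfl)
  · refine ContinuousOn.intervalIntegrable ?_
    rw [uIcc_of_le hcd]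
    exact slice hF.continuousOn 0 (Metric.mem_closedBall_self hδ.le)
  · exact ((slice (smoothOn_partialE hU hF).continuousOn 0
      (Metric.mem_closedBall_self hδ.le)).aestronglyMeasurable measurableSet_Icc).mono_measure
      (MeasureTheory.Measure.restrict_mono hι le_rfl)
  · exact .of_forall fun s hs ε hε => hC (ε, s) ⟨hε, hι hs⟩
  · exact .of_forall fun s hs ε hε => hasDerivAt_partialE hU hF (q := (ε, s)) (hK ⟨hε, hι hs⟩)

end Partial

/-! ### Total derivatives -/

/-- `f` is on `J` the derivative of a smooth function that vanishes at `c` and `d`. -/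
def IsTotalDeriv (J : Set ℝ) (c d : ℝ) (f : ℝ → ℝ) : Prop :=
  ∃ B : ℝ → ℝ, ContDiffOn ℝ ∞ B J ∧ B c = 0 ∧ B d = 0 ∧ ∀ s ∈ J, deriv B s = f s

namespace IsTotalDeriv

variable {J : Set ℝ} {c d : ℝ} {f g : ℝ → ℝ}

theorem congr (hf : IsTotalDeriv J c d f) (h : ∀ s ∈ J, g s = f s) : IsTotalDeriv J c d g := by
  obtain ⟨B, h1, h2, h3, h4⟩ := hf
  exact ⟨B, h1, h2, h3, fun s hs => (h4 s hs).trans (h s hs).symm⟩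

theorem zero : IsTotalDeriv J c d fun _ => 0 :=
  ⟨fun _ => 0, contDiffOn_const, rfl, rfl, fun s _ => by simp⟩

theorem add (hJ : IsOpen J) (hf : IsTotalDeriv J c d f) (hg : IsTotalDeriv J c d g) :
    IsTotalDeriv J c d fun s => f s + g s := by
  obtain ⟨B, h1, h2, h3, h4⟩ := hf
  obtain ⟨B', h1', h2', h3', h4'⟩ := hg
  refine ⟨fun s => B s + B' s, h1.add h1', by simp [h2, h2'], by simp [h3, h3'], fun s hs => ?_⟩
  simp only [← h4 s hs, ← h4' s hs]
  exact ((hasDerivAt_of_smoothOn hJ h1 hs).add (hasDerivAt_of_smoothOn hJ h1' hs)).deriv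

theorem neg (hf : IsTotalDeriv J c d f) : IsTotalDeriv J c d fun s => -f s := by
  obtain ⟨B, h1, h2, h3, h4⟩ := hf
  refine ⟨fun s => -B s, h1.neg, by simp [h2], by simp [h3], fun s hs => ?_⟩
  simp only [← h4 s hs, deriv.fun_neg]

theorem sum (hJ : IsOpen J) {ι : Type*} (S : Finset ι) {f : ι → ℝ → ℝ}
    (h : ∀ i ∈ S, IsTotalDeriv J c d (f i)) : IsTotalDeriv J c d fun s => ∑ i ∈ S, f i s := by
  classical
  induction S using Finset.induction_on with
  | empty => simpa using zero
  | insert a S ha ih =>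
    simp only [Finset.sum_insert ha]
    exact (h a (by simp)).add hJ (ih fun i hi => h i (by simp [hi]))

/-- Integration by parts: boundary values enter only through g, so f may be arbitrary at the
endpoints. -/
theorem deriv_mul_add (hJ : IsOpen J) (hf : ContDiffOn ℝ ∞ f J) (hg : ContDiffOn ℝ ∞ g J)
    (hc : g c = 0) (hd : g d = 0) :
    IsTotalDeriv J c d fun s => deriv f s * g s + f s * deriv g s :=
  ⟨fun s => f s * g s, hf.mul hg, by simp [hc], by simp [hd], fun _ hs =>
    ((hasDerivAt_of_smoothOn hJ hf hs).mul (hasDerivAt_of_smoothOn hJ hg hs)).deriv⟩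

theorem integral_eq_zero (hJ : IsOpen J) (hf : IsTotalDeriv J c d f) (hcd : c ≤ d)
    (hsub : Icc c d ⊆ J) : ∫ s in c..d, f s = 0 := by
  obtain ⟨B, h1, h2, h3, h4⟩ := hf
  rw [← uIcc_of_le hcd] at hsub
  rw [intervalIntegral.integral_congr (g := deriv B) fun s hs => (h4 s (hsub hs)).symm,
    intervalIntegral.integral_deriv_eq_sub
      (fun s hs => (hasDerivAt_of_smoothOn hJ h1 (hsub hs)).differentiableAt)
      ((smoothOn_deriv hJ h1).continuousOn.mono hsub).intervalIntegrable, h2, h3, sub_zero]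

/-- Functions that differ by a total derivative have the same integral. -/
theorem integral_eq (hJ : IsOpen J) (h : IsTotalDeriv J c d fun s => f s - g s) (hcd : c ≤ d)
    (hsub : Icc c d ⊆ J) (hf : ContinuousOn f J) (hg : ContinuousOn g J) :
    ∫ s in c..d, f s = ∫ s in c..d, g s := by
  have h0 := h.integral_eq_zero hJ hcd hsub
  rw [← uIcc_of_le hcd] at hsub
  rw [intervalIntegral.integral_sub (hf.mono hsub).intervalIntegrable
    (hg.mono hsub).intervalIntegrable] at h0
  linarith

end IsTotalDeriv

/-! ### The Frenet–Serret frame -/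

/-- `x` is on the open set `J` a smooth curve of positive curvature, parametrized by arc length. -/
structure IsFrenetCurve (J : Set ℝ) (x : ℝ → Fin 3 → ℝ) : Prop where
  isOpen : IsOpen J
  smooth : ContDiffOn ℝ ∞ x J
  speed_eq : ∀ s ∈ J, speed x s = 1
  pos : ∀ s ∈ J, 0 < curvature x s

/-- Expansion of a vector in a positively oriented orthonormal frame. -/
theorem eq_frame_expansion {T N : Fin 3 → ℝ} (hTT : T ⬝ᵥ T = 1) (hNN : N ⬝ᵥ N = 1)
    (hTN : T ⬝ᵥ N = 0) (u : Fin 3 → ℝ) :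
    u = (u ⬝ᵥ T) • T + (u ⬝ᵥ N) • N + (u ⬝ᵥ T ⨯₃ N) • (T ⨯₃ N) := by
  set A : Matrix (Fin 3) (Fin 3) ℝ := Matrix.of ![T, N, T ⨯₃ N] with hA
  have h1 : A * Aᵀ = 1 := by
    have hNT : N ⬝ᵥ T = 0 := by rw [dotProduct_comm]; exact hTN
    have e1 : T ⬝ᵥ T ⨯₃ N = 0 := dot_self_cross T N
    have e2 : N ⬝ᵥ T ⨯₃ N = 0 := dot_cross_self T N
    have e3 : T ⨯₃ N ⬝ᵥ T ⨯₃ N = 1 := by rw [cross_dot_cross, hTT, hNN, hTN]; simp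
    have key : ∀ i j, (A * Aᵀ) i j = A i ⬝ᵥ A j := fun i j => by
      simp [Matrix.mul_apply, dotProduct]
    ext i j
    rw [key]
    change ![T, N, T ⨯₃ N] i ⬝ᵥ ![T, N, T ⨯₃ N] j = _
    fin_cases i <;> fin_cases j <;>
      simp [hTT, hNN, hTN, hNT, e1, e2, e3, dotProduct_comm (T ⨯₃ N)]
  -- Orthonormal rows force orthonormal columns, and u = Aᵀ(Au) is the expansion.
  have h2 : Aᵀ * A = 1 := mul_eq_one_comm.1 h1
  have h3 : u = Aᵀ *ᵥ (A *ᵥ u) := by rw [Matrix.mulVec_mulVec, h2, Matrix.one_mulVec]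
  rw [Matrix.mulVec_transpose] at h3
  conv_lhs => rw [h3]
  ext i
  simp [Matrix.vecMul, Matrix.mulVec, hA, dotProduct, Fin.sum_univ_three]
  ring

namespace IsFrenetCurve

variable {J : Set ℝ} {x : ℝ → Fin 3 → ℝ} {s : ℝ}

theorem smooth_tangent (h : IsFrenetCurve J x) : ContDiffOn ℝ ∞ (tangent x) J :=
  smoothOn_deriv h.isOpen h.smooth

theorem tangent_dot_tangent (h : IsFrenetCurve J x) (hs : s ∈ J) :
    tangent x s ⬝ᵥ tangent x s = 1 := by
  rw [← len_sq, show len (tangent x s) = 1 from h.speed_eq s hs, one_pow]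

theorem len_tangent (h : IsFrenetCurve J x) (hs : s ∈ J) : len (deriv x s) = 1 :=
  h.speed_eq s hs

theorem curvature_eq (h : IsFrenetCurve J x) (hs : s ∈ J) :
    curvature x s = len (deriv x s ⨯₃ iteratedDeriv 2 x s) := by
  rw [curvature, h.len_tangent hs]; simp

theorem cross_ne_zero (h : IsFrenetCurve J x) (hs : s ∈ J) :
    deriv x s ⨯₃ iteratedDeriv 2 x s ≠ 0 := by
  intro h0
  have := h.pos s hs
  rw [h.curvature_eq hs, h0] at this
  simp [len] at this

theorem smooth_cross (h : IsFrenetCurve J x) :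
    ContDiffOn ℝ ∞ (fun s => deriv x s ⨯₃ iteratedDeriv 2 x s) J :=
  h.smooth_tangent.crossProduct (smoothOn_iteratedDeriv h.isOpen h.smooth 2)

theorem smooth_curvature (h : IsFrenetCurve J x) : ContDiffOn ℝ ∞ (curvature x) J :=
  (smoothOn_len h.smooth_cross fun _ hs => h.cross_ne_zero hs).congr fun _ hs => h.curvature_eq hs

theorem smooth_torsion (h : IsFrenetCurve J x) : ContDiffOn ℝ ∞ (torsion x) J :=
  ((smoothOn_iteratedDeriv h.isOpen h.smooth 3).dotProduct h.smooth_cross).div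
    ((smoothOn_len h.smooth_cross fun _ hs => h.cross_ne_zero hs).pow 2)
    fun _ hs => pow_ne_zero 2 (len_pos (h.cross_ne_zero hs)).ne'

theorem smooth_inv_curvature (h : IsFrenetCurve J x) :
    ContDiffOn ℝ ∞ (fun s => (curvature x s)⁻¹) J :=
  h.smooth_curvature.inv fun s hs => (h.pos s hs).ne'

theorem smooth_normal (h : IsFrenetCurve J x) : ContDiffOn ℝ ∞ (normal x) J :=
  h.smooth_inv_curvature.smul (smoothOn_iteratedDeriv h.isOpen h.smooth 2)

theorem smooth_binormal (h : IsFrenetCurve J x) : ContDiffOn ℝ ∞ (binormal x) J :=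
  h.smooth_inv_curvature.smul h.smooth_cross

theorem iteratedDeriv_two_eq (h : IsFrenetCurve J x) (hs : s ∈ J) :
    iteratedDeriv 2 x s = curvature x s • normal x s := by
  rw [normal, smul_smul, mul_inv_cancel₀ (h.pos s hs).ne', one_smul]

theorem binormal_eq (x : ℝ → Fin 3 → ℝ) (s : ℝ) :
    binormal x s = tangent x s ⨯₃ normal x s := by
  rw [binormal, normal, tangent, map_smul]

theorem hasDerivAt_curve (h : IsFrenetCurve J x) (hs : s ∈ J) : HasDerivAt x (tangent x s) s :=
  hasDerivAt_of_smoothOn h.isOpen h.smooth hs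

theorem hasDerivAt_tangent (h : IsFrenetCurve J x) (hs : s ∈ J) :
    HasDerivAt (tangent x) (curvature x s • normal x s) s := by
  rw [← h.iteratedDeriv_two_eq hs]
  have := hasDerivAt_iteratedDeriv h.isOpen h.smooth 1 hs
  rwa [iteratedDeriv_one] at this

theorem tangent_dot_normal (h : IsFrenetCurve J x) (hs : s ∈ J) :
    tangent x s ⬝ᵥ normal x s = 0 := by
  have h1 := (h.hasDerivAt_tangent hs).dotProduct (h.hasDerivAt_tangent hs)
  have h2 : (fun r => tangent x r ⬝ᵥ tangent x r) =ᶠ[𝓝 s] fun _ => (1 : ℝ) :=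
    eventually_of_mem (h.isOpen.mem_nhds hs) fun r hr => h.tangent_dot_tangent hr
  have h3 := h1.unique ((hasDerivAt_const s (1 : ℝ)).congr_of_eventuallyEq h2)
  rw [smul_dotProduct, dotProduct_smul, dotProduct_comm (normal x s), ← two_mul] at h3
  simpa [(h.pos s hs).ne'] using h3

theorem normal_dot_normal (h : IsFrenetCurve J x) (hs : s ∈ J) :
    normal x s ⬝ᵥ normal x s = 1 := by
  have h1 := len_sq (deriv x s ⨯₃ iteratedDeriv 2 x s)
  have h2 : deriv x s ⬝ᵥ deriv x s = 1 := h.tangent_dot_tangent hs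
  have h3 : deriv x s ⬝ᵥ normal x s = 0 := h.tangent_dot_normal hs
  -- Lagrange's identity for T × κN turns h1 into κ² = κ² (N · N), since T · T = 1 and T · N = 0.
  rw [← h.curvature_eq hs] at h1
  simp only [h.iteratedDeriv_two_eq hs, cross_dot_cross, h2, dotProduct_smul, h3,
    zero_mul, mul_zero, sub_zero, one_mul, smul_dotProduct, smul_eq_mul, ← mul_assoc, ← sq] at h1
  exact (mul_eq_left₀ (pow_ne_zero 2 (h.pos s hs).ne')).1 h1.symm

theorem tangent_dot_binormal (x : ℝ → Fin 3 → ℝ) (s : ℝ) :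
    tangent x s ⬝ᵥ binormal x s = 0 := by rw [binormal_eq x s, dot_self_cross]

theorem normal_dot_binormal (x : ℝ → Fin 3 → ℝ) (s : ℝ) :
    normal x s ⬝ᵥ binormal x s = 0 := by rw [binormal_eq x s, dot_cross_self]

theorem binormal_dot_binormal (h : IsFrenetCurve J x) (hs : s ∈ J) :
    binormal x s ⬝ᵥ binormal x s = 1 := by
  rw [binormal_eq x s, cross_dot_cross, h.tangent_dot_tangent hs, h.normal_dot_normal hs,
    h.tangent_dot_normal hs]
  simp

theorem normal_cross_binormal (h : IsFrenetCurve J x) (hs : s ∈ J) :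
    normal x s ⨯₃ binormal x s = tangent x s := by
  rw [binormal_eq x s, cross_cross_eq_smul_sub_smul',
    h.normal_dot_normal hs, h.tangent_dot_normal hs]
  simp

theorem binormal_cross_tangent (h : IsFrenetCurve J x) (hs : s ∈ J) :
    binormal x s ⨯₃ tangent x s = normal x s := by
  rw [binormal_eq x s, cross_cross_eq_smul_sub_smul, dotProduct_comm (normal x s) (tangent x s),
    h.tangent_dot_tangent hs, h.tangent_dot_normal hs]
  simp

theorem expansion (h : IsFrenetCurve J x) (hs : s ∈ J) (u : Fin 3 → ℝ) :
    u = (u ⬝ᵥ tangent x s) • tangent x s + (u ⬝ᵥ normal x s) • normal x s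
      + (u ⬝ᵥ binormal x s) • binormal x s := by
  rw [binormal_eq x s]
  exact eq_frame_expansion (h.tangent_dot_tangent hs) (h.normal_dot_normal hs)
    (h.tangent_dot_normal hs) u

theorem iteratedDeriv_three_eq (h : IsFrenetCurve J x) (hs : s ∈ J) :
    iteratedDeriv 3 x s
      = deriv (curvature x) s • normal x s + curvature x s • deriv (normal x) s := by
  have h1 := hasDerivAt_iteratedDeriv h.isOpen h.smooth 2 hs
  have h2 := (hasDerivAt_of_smoothOn h.isOpen h.smooth_curvature hs).smul
    (hasDerivAt_of_smoothOn h.isOpen h.smooth_normal hs)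
  have h3 : iteratedDeriv 2 x =ᶠ[𝓝 s] fun r => curvature x r • normal x r :=
    eventually_of_mem (h.isOpen.mem_nhds hs) fun r hr => h.iteratedDeriv_two_eq hr
  rw [h1.unique (h2.congr_of_eventuallyEq h3), add_comm]

theorem cross_eq (h : IsFrenetCurve J x) (hs : s ∈ J) :
    deriv x s ⨯₃ iteratedDeriv 2 x s = curvature x s • binormal x s := by
  rw [binormal, smul_smul, mul_inv_cancel₀ (h.pos s hs).ne', one_smul]

theorem hasDerivAt_normal (h : IsFrenetCurve J x) (hs : s ∈ J) :
    HasDerivAt (normal x) (-curvature x s • tangent x s + torsion x s • binormal x s) s := by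
  have hN := hasDerivAt_of_smoothOn h.isOpen h.smooth_normal hs
  refine hN.congr_deriv ?_
  have hn := hN.dotProduct hN
  have ht := (h.hasDerivAt_tangent hs).dotProduct hN
  have e1 : (fun r => normal x r ⬝ᵥ normal x r) =ᶠ[𝓝 s] fun _ => (1 : ℝ) :=
    eventually_of_mem (h.isOpen.mem_nhds hs) fun r hr => h.normal_dot_normal hr
  have e2 : (fun r => tangent x r ⬝ᵥ normal x r) =ᶠ[𝓝 s] fun _ => (0 : ℝ) :=
    eventually_of_mem (h.isOpen.mem_nhds hs) fun r hr => h.tangent_dot_normal hr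
  have f1 := hn.unique ((hasDerivAt_const s (1 : ℝ)).congr_of_eventuallyEq e1)
  have f2 := ht.unique ((hasDerivAt_const s (0 : ℝ)).congr_of_eventuallyEq e2)
  rw [dotProduct_comm (normal x s) (deriv (normal x) s)] at f1
  rw [smul_dotProduct, h.normal_dot_normal hs, dotProduct_comm (tangent x s), smul_eq_mul] at f2
  have hκ := (h.pos s hs).ne'
  -- In x_sss = κ_s N + κ N_s only the second term has a component along B, and the triple product
  -- is taken with κB.
  have f3 : torsion x s = deriv (normal x) s ⬝ᵥ binormal x s := by
    rw [torsion, ← h.curvature_eq hs, h.cross_eq hs, h.iteratedDeriv_three_eq hs, dotProduct_smul,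
      add_dotProduct, smul_dotProduct, smul_dotProduct, normal_dot_binormal x s]
    simp only [smul_eq_mul]
    field_simp
    ring
  conv_lhs => rw [h.expansion hs (deriv (normal x) s)]
  rw [← f3, show deriv (normal x) s ⬝ᵥ normal x s = 0 by linarith,
    show deriv (normal x) s ⬝ᵥ tangent x s = -curvature x s by linarith, zero_smul, add_zero]

theorem hasDerivAt_binormal (h : IsFrenetCurve J x) (hs : s ∈ J) :
    HasDerivAt (binormal x) (-torsion x s • normal x s) s := by
  have h1 := (h.hasDerivAt_tangent hs).crossProduct (h.hasDerivAt_normal hs)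
  have h2 : binormal x =ᶠ[𝓝 s] fun r => tangent x r ⨯₃ normal x r :=
    eventually_of_mem (h.isOpen.mem_nhds hs) fun r hr => binormal_eq x r
  refine (h1.congr_of_eventuallyEq h2).congr_deriv ?_
  have h3 : tangent x s ⨯₃ binormal x s = -normal x s := by
    rw [← cross_anticomm, h.binormal_cross_tangent hs]
  rw [map_smul, LinearMap.smul_apply, cross_self, map_add, map_smul, map_smul, cross_self, h3]
  simp

theorem frenet_mem (h : IsFrenetCurve J x) (hs : s ∈ J) :
    frenet x s ∈ Matrix.specialOrthogonalGroup (Fin 3) ℝ := by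
  have hcol : (frenet x s)ᵀ * frenet x s = 1 := by
    have hNT := h.tangent_dot_normal hs
    have hBT := tangent_dot_binormal x s
    have hBN := normal_dot_binormal x s
    rw [dotProduct_comm] at hNT hBT hBN
    have key : ∀ i j, ((frenet x s)ᵀ * frenet x s) i j
        = ![tangent x s, normal x s, binormal x s] i ⬝ᵥ ![tangent x s, normal x s, binormal x s] j := by
      intro i j
      fin_cases i <;> fin_cases j <;> simp [Matrix.mul_apply, dotProduct, frenet]
    ext i j
    rw [key]
    fin_cases i <;> fin_cases j <;>
      simp [h.tangent_dot_tangent hs, h.normal_dot_normal hs, h.binormal_dot_binormal hs,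
        h.tangent_dot_normal hs, tangent_dot_binormal x s, normal_dot_binormal x s, hNT, hBT, hBN]
  rw [Matrix.mem_specialOrthogonalGroup_iff, Matrix.mem_orthogonalGroup_iff']
  refine ⟨hcol, ?_⟩
  -- The determinant is T · (N × B) = T · T = 1.
  have h1 := triple_product_eq_det (tangent x s) (normal x s) (binormal x s)
  rw [h.normal_cross_binormal hs, h.tangent_dot_tangent hs] at h1
  rw [← Matrix.det_transpose, h1]
  congr 1
  ext i j
  fin_cases i <;> rfl

/-- A rotation commutes with the cross product. In coordinates this is the row orthonormality of the
frame matrix together with N × B = T, B × T = N, T × N = B; every entry of the claim is a polynomial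
consequence of these relations. -/
theorem generator_frenet (h : IsFrenetCurve J x) (hs : s ∈ J) (j : Fin 3 ⊕ Fin 3)
    (p : Fin 3 → ℝ) :
    generator j (frenet x s *ᵥ p + x s) =
      frenet x s *ᵥ ∑ k, adFrame x s j k • generator k p := by
  have hr : frenet x s * (frenet x s)ᵀ = 1 :=
    (Matrix.mem_orthogonalGroup_iff (Fin 3) ℝ).1
      (Matrix.mem_specialOrthogonalGroup_iff.1 (h.frenet_mem hs)).1
  have key : ∀ i j, tangent x s i * tangent x s j + normal x s i * normal x s j
      + binormal x s i * binormal x s j = (1 : Matrix (Fin 3) (Fin 3) ℝ) i j := fun i j => by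
    rw [← hr]; simp [Matrix.mul_apply, frenet, Fin.sum_univ_three]
  have c1 := h.normal_cross_binormal hs
  have c2 := h.binormal_cross_tangent hs
  have c3 := (binormal_eq x s).symm
  rw [cross_apply] at c1 c2 c3
  have k00 := key 0 0
  have k01 := key 0 1
  have k02 := key 0 2
  have k11 := key 1 1
  have k12 := key 1 2
  have k22 := key 2 2
  have t0 := congrFun c1 0
  have t1 := congrFun c1 1
  have t2 := congrFun c1 2
  have n0 := congrFun c2 0
  have n1 := congrFun c2 1
  have n2 := congrFun c2 2
  have b0 := congrFun c3 0
  have b1 := congrFun c3 1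
  have b2 := congrFun c3 2
  simp at k00 k01 k02 k11 k12 k22 t0 t1 t2 n0 n1 n2 b0 b1 b2
  ext i
  rcases j with j | j <;> fin_cases j <;> fin_cases i <;>
    simp [generator, adFrame, frenet, matD, matX, Matrix.mulVec, dotProduct, Fin.sum_univ_three,
      Matrix.mul_apply, Matrix.diagonal, Pi.single_apply]
  all_goals grind

end IsFrenetCurve

/-! ### Euler operators along a pair of functions -/

/-- `L` is smooth near the jets of the smooth functions `κ, τ` on the open set `J`. -/
structure IsRegularAlong {n : ℕ} (L : Jets n → ℝ) (Ω : Set (Jets n)) (J : Set ℝ)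
    (κ τ : ℝ → ℝ) : Prop where
  isOpen_domain : IsOpen Ω
  smooth_lagrangian : ContDiffOn ℝ ∞ L Ω
  isOpen : IsOpen J
  smooth_fst : ContDiffOn ℝ ∞ κ J
  smooth_snd : ContDiffOn ℝ ∞ τ J
  jet_mem : ∀ s ∈ J, jet n κ τ s ∈ Ω

/-- The derivative telescopes: with t_i = (-1)^i g_i f_{m+1-i}, the i-th summand has derivative t_i
- t_{i+1}, so only t_0 and t_m survive. -/
theorem hasDerivAt_alternating_sum {J : Set ℝ} (hJ : IsOpen J) {g f : ℝ → ℝ}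
    (hg : ContDiffOn ℝ ∞ g J) (hf : ContDiffOn ℝ ∞ f J) (m : ℕ) {s : ℝ} (hs : s ∈ J) :
    HasDerivAt (fun r => ∑ i ∈ Finset.range m,
        (-1 : ℝ) ^ i * iteratedDeriv i g r * iteratedDeriv (m - i) f r)
      (g s * iteratedDeriv (m + 1) f s - (-1) ^ m * iteratedDeriv m g s * deriv f s) s := by
  have h := HasDerivAt.fun_sum (u := Finset.range m) fun i _ =>
    ((hasDerivAt_iteratedDeriv hJ hg i hs).const_mul ((-1 : ℝ) ^ i)).mul
      (hasDerivAt_iteratedDeriv hJ hf (m - i) hs)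
  refine h.congr_deriv ?_
  have ht := Finset.sum_range_sub' (fun i =>
    (-1 : ℝ) ^ i * iteratedDeriv i g s * iteratedDeriv (m + 1 - i) f s) m
  simp only [pow_zero, iteratedDeriv_zero, one_mul, Nat.sub_zero, Nat.add_sub_cancel_left,
    iteratedDeriv_one] at ht
  rw [← ht]
  refine Finset.sum_congr rfl fun i hi => ?_
  rw [Nat.add_sub_add_right, Nat.sub_add_comm (Finset.mem_range.1 hi).le]
  ring

theorem fderiv_jet_apply {n : ℕ} (L : Jets n → ℝ) (p : Jets n) (a b : Fin (n + 1) → ℝ) :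
    fderiv ℝ L p (a, b) = ∑ m, fderiv ℝ L p (Pi.single m 1, 0) * a m
      + ∑ m, fderiv ℝ L p (0, Pi.single m 1) * b m := by
  have h1 : (a, b) = ∑ m, a m • ((Pi.single m 1, 0) : Jets n)
      + ∑ m, b m • ((0, Pi.single m 1) : Jets n) := by
    refine Prod.ext ?_ ?_ <;> ext j <;>
      simp [Prod.fst_sum, Prod.snd_sum, Finset.sum_apply, Pi.single_apply]
  rw [h1]
  simp only [map_add, map_sum, map_smul, smul_eq_mul, mul_comm]

namespace IsRegularAlong

variable {n : ℕ} {L : Jets n → ℝ} {Ω : Set (Jets n)} {J : Set ℝ} {κ τ : ℝ → ℝ} {s : ℝ}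

theorem smooth_jet (h : IsRegularAlong L Ω J κ τ) : ContDiffOn ℝ ∞ (jet n κ τ) J :=
  (contDiffOn_pi.2 fun _ => smoothOn_iteratedDeriv h.isOpen h.smooth_fst _).prodMk
    (contDiffOn_pi.2 fun _ => smoothOn_iteratedDeriv h.isOpen h.smooth_snd _)

theorem smooth_fderiv_apply (h : IsRegularAlong L Ω J κ τ) (w : Jets n) :
    ContDiffOn ℝ ∞ (fun s => fderiv ℝ L (jet n κ τ s) w) J :=
  ((h.smooth_lagrangian.fderiv_of_isOpen (m := ∞) h.isOpen_domain (by simp)).comp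
    h.smooth_jet h.jet_mem).clm_apply contDiffOn_const

theorem smooth_dLκ (h : IsRegularAlong L Ω J κ τ) (m : Fin (n + 1)) :
    ContDiffOn ℝ ∞ (dLκ L κ τ m) J := h.smooth_fderiv_apply _

theorem smooth_dLτ (h : IsRegularAlong L Ω J κ τ) (m : Fin (n + 1)) :
    ContDiffOn ℝ ∞ (dLτ L κ τ m) J := h.smooth_fderiv_apply _

theorem smooth_eulerκ (h : IsRegularAlong L Ω J κ τ) : ContDiffOn ℝ ∞ (eulerκ L κ τ) J :=
  ContDiffOn.sum fun m _ => contDiffOn_const.mul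
    (smoothOn_iteratedDeriv h.isOpen (h.smooth_dLκ m) m)

theorem smooth_eulerτ (h : IsRegularAlong L Ω J κ τ) : ContDiffOn ℝ ∞ (eulerτ L κ τ) J :=
  ContDiffOn.sum fun m _ => contDiffOn_const.mul
    (smoothOn_iteratedDeriv h.isOpen (h.smooth_dLτ m) m)

theorem smooth_lagrangian_jet (h : IsRegularAlong L Ω J κ τ) :
    ContDiffOn ℝ ∞ (fun s => L (jet n κ τ s)) J :=
  h.smooth_lagrangian.comp h.smooth_jet h.jet_mem

theorem smooth_multiplier (h : IsRegularAlong L Ω J κ τ) :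
    ContDiffOn ℝ ∞ (multiplier L κ τ) J :=
  ((((contDiffOn_const.mul h.smooth_snd).mul h.smooth_eulerτ).sub h.smooth_lagrangian_jet).add
    (ContDiffOn.sum fun m _ => ContDiffOn.sum fun i _ =>
      (contDiffOn_const.mul (smoothOn_iteratedDeriv h.isOpen (h.smooth_dLκ m) i)).mul
        (smoothOn_iteratedDeriv h.isOpen h.smooth_fst _))).add
    (ContDiffOn.sum fun m _ => ContDiffOn.sum fun i _ =>
      (contDiffOn_const.mul (smoothOn_iteratedDeriv h.isOpen (h.smooth_dLτ m) i)).mul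
        (smoothOn_iteratedDeriv h.isOpen h.smooth_snd _))

theorem hasDerivAt_lagrangian_jet (h : IsRegularAlong L Ω J κ τ) (hs : s ∈ J) :
    HasDerivAt (fun r => L (jet n κ τ r))
      (∑ m : Fin (n + 1), dLκ L κ τ m s * iteratedDeriv (m + 1) κ s
        + ∑ m : Fin (n + 1), dLτ L κ τ m s * iteratedDeriv (m + 1) τ s) s := by
  have hj : HasDerivAt (jet n κ τ) ((fun m : Fin (n + 1) => iteratedDeriv (m + 1) κ s,
      fun m : Fin (n + 1) => iteratedDeriv (m + 1) τ s) : Jets n) s :=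
    (hasDerivAt_pi.2 fun m : Fin (n + 1) =>
      hasDerivAt_iteratedDeriv h.isOpen h.smooth_fst m hs).prodMk
    (hasDerivAt_pi.2 fun m : Fin (n + 1) =>
      hasDerivAt_iteratedDeriv h.isOpen h.smooth_snd m hs)
  have hL := ((h.smooth_lagrangian.differentiableOn (by simp)).differentiableAt
    (h.isOpen_domain.mem_nhds (h.jet_mem s hs))).hasFDerivAt
  refine (hL.comp_hasDerivAt s hj).congr_deriv ?_
  rw [fderiv_jet_apply]
  rfl

/-- Conservation of energy in Ostrogradsky's form. L has no explicit dependence on s, so its total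
derivative cancels the leading ends t_0 of the telescoping sums; the other ends assemble to -κ_s E^κ
- τ_s E^τ. -/
theorem hasDerivAt_multiplier (h : IsRegularAlong L Ω J κ τ) (hs : s ∈ J) :
    HasDerivAt (multiplier L κ τ) (deriv (fun r => 2 * τ r * eulerτ L κ τ r) s
      - deriv κ s * eulerκ L κ τ s - deriv τ s * eulerτ L κ τ s) s := by
  have h1 := hasDerivAt_of_smoothOn h.isOpen
    ((contDiffOn_const (c := (2 : ℝ)).mul h.smooth_snd).mul h.smooth_eulerτ) hs
  have h2 := HasDerivAt.fun_sum (u := Finset.univ) fun (m : Fin (n + 1)) _ =>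
    hasDerivAt_alternating_sum h.isOpen (h.smooth_dLκ m) h.smooth_fst m hs
  have h3 := HasDerivAt.fun_sum (u := Finset.univ) fun (m : Fin (n + 1)) _ =>
    hasDerivAt_alternating_sum h.isOpen (h.smooth_dLτ m) h.smooth_snd m hs
  refine (((h1.sub (h.hasDerivAt_lagrangian_jet hs)).add h2).add h3).congr_deriv ?_
  simp only [Finset.sum_sub_distrib, ← Finset.sum_mul]
  rw [eulerκ, show eulerτ L κ τ s = _ from rfl, eulerτ]
  ring

theorem elX_multiplier (h : IsRegularAlong L Ω J κ τ) (hs : s ∈ J) :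
    elX L κ τ (multiplier L κ τ) s = 0 := by
  rw [elX, (h.hasDerivAt_multiplier hs).deriv]; ring

/-- The multiplier is determined by `E^x = 0` up to a constant. -/
theorem elX_eq_zero_iff (h : IsRegularAlong L Ω J κ τ) (hJ : IsPreconnected J) (lam : ℝ → ℝ) :
    (DifferentiableOn ℝ lam J ∧ ∀ s ∈ J, elX L κ τ lam s = 0) ↔
      ∃ C : ℝ, ∀ s ∈ J, lam s = multiplier L κ τ s + C := by
  have hd : DifferentiableOn ℝ (multiplier L κ τ) J := h.smooth_multiplier.differentiableOn (by simp)
  constructor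
  · rintro ⟨h1, h2⟩
    -- E^x contains the multiplier only through λ_s, so two solutions differ by a function of zero
    -- derivative on the connected set J.
    obtain ⟨C, hC⟩ := h.isOpen.exists_is_const_of_deriv_eq_zero hJ (h1.sub hd) fun s hs => by
      have e1 := h2 s hs
      have e2 := h.elX_multiplier hs
      rw [elX] at e1 e2
      rw [deriv_sub (h1.differentiableAt (h.isOpen.mem_nhds hs))
        (hd.differentiableAt (h.isOpen.mem_nhds hs)), Pi.zero_apply]
      linarith
    exact ⟨C, fun s hs => by rw [← hC s hs]; simp⟩
  · rintro ⟨C, hC⟩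
    refine ⟨(hd.add_const C).congr hC, fun s hs => ?_⟩
    rw [← h.elX_multiplier hs, elX, elX,
      eqOn_deriv h.isOpen (g := fun s => multiplier L κ τ s + C) hC hs, deriv_add_const]

end IsRegularAlong

/-! ### Linear and angular momentum -/

section Momentum

variable {n : ℕ} (L : Jets n → ℝ) (x : ℝ → Fin 3 → ℝ) (lam : ℝ → ℝ)

/-- The vector with the first three components of `υ` as coordinates in the Frenet frame. -/
noncomputable def momentum (s : ℝ) : Fin 3 → ℝ :=
  (torsion x s * eulerτ L (curvature x) (torsion x) s
      - curvature x s * eulerκ L (curvature x) (torsion x) s - lam s) • tangent x s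
    + (-deriv (eulerκ L (curvature x) (torsion x)) s
      - torsion x s / curvature x s * deriv (eulerτ L (curvature x) (torsion x)) s) • normal x s
    + (1 / curvature x s * iteratedDeriv 2 (eulerτ L (curvature x) (torsion x)) s
      - deriv (curvature x) s / curvature x s ^ 2 * deriv (eulerτ L (curvature x) (torsion x)) s
      + curvature x s * eulerτ L (curvature x) (torsion x) s
      - torsion x s * eulerκ L (curvature x) (torsion x) s) • binormal x s

/-- The angular momentum with respect to the point of the curve. -/
noncomputable def spin (s : ℝ) : Fin 3 → ℝ :=
  eulerτ L (curvature x) (torsion x) s • tangent x s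
    + (1 / curvature x s * deriv (eulerτ L (curvature x) (torsion x)) s) • normal x s
    + eulerκ L (curvature x) (torsion x) s • binormal x s

/-- The matrix X acts as x ×. Conjugation by D flips the sign of the middle entry of `upsilon`,
which is why the normal coefficient of `spin` is positive. -/
theorem adFrame_mulVec_upsilon (s : ℝ) :
    adFrame x s *ᵥ upsilon L (curvature x) (torsion x) lam s =
      Sum.elim (momentum L x lam s) (matD *ᵥ (x s ⨯₃ momentum L x lam s + spin L x s)) := by
  have h1 : ∀ a b c : ℝ, frenet x s *ᵥ ![a, b, c]
      = a • tangent x s + b • normal x s + c • binormal x s := fun a b c => by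
    ext i
    simp [Matrix.mulVec, dotProduct, Fin.sum_univ_three, frenet, mul_comm]
  have h2 : ∀ u, matX (x s) *ᵥ u = x s ⨯₃ u := fun u => by
    ext i
    fin_cases i <;> simp [matX, Matrix.mulVec, dotProduct, Fin.sum_univ_three, cross_apply] <;> ring
  have h3 : ∀ a b c : ℝ, matD *ᵥ ![a, b, c] = ![a, -b, c] := fun a b c => by
    ext i
    fin_cases i <;> simp [matD, Matrix.mulVec_diagonal]
  rw [adFrame, upsilon, Matrix.fromBlocks_mulVec]
  congr 1
  · rw [Matrix.zero_mulVec, add_zero, Sum.elim_comp_inl, h1, momentum]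
  · rw [Sum.elim_comp_inl, Sum.elim_comp_inr, ← Matrix.mulVec_mulVec, ← Matrix.mulVec_mulVec,
      ← Matrix.mulVec_mulVec, ← Matrix.mulVec_mulVec, h1, h2, h3, h1, ← Matrix.mulVec_add,
      momentum, spin, neg_mul, neg_neg]

variable {L x lam} {Ω : Set (Jets n)} {J : Set ℝ} {s : ℝ}

/-- The Euler–Lagrange expressions are the frame components of the negative force: differentiate the
three coefficients and add the Frenet–Serret rotation of the frame. Mere differentiability of λ
suffices, as needed for the conservation laws. -/
theorem hasDerivAt_momentum (hx : IsFrenetCurve J x)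
    (hL : IsRegularAlong L Ω J (curvature x) (torsion x)) (hs : s ∈ J)
    (hlam : DifferentiableAt ℝ lam s) :
    HasDerivAt (momentum L x lam)
      (-(elX L (curvature x) (torsion x) lam s • tangent x s
        + elY L (curvature x) (torsion x) lam s • normal x s
        + elZ L (curvature x) (torsion x) s • binormal x s)) s := by
  have hκ := hasDerivAt_of_smoothOn hx.isOpen hx.smooth_curvature hs
  have hκ1 := hasDerivAt_iteratedDeriv hx.isOpen hx.smooth_curvature 1 hs
  have hτ := hasDerivAt_of_smoothOn hx.isOpen hx.smooth_torsion hs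
  have hE := hasDerivAt_of_smoothOn hx.isOpen hL.smooth_eulerκ hs
  have hE1 := hasDerivAt_iteratedDeriv hx.isOpen hL.smooth_eulerκ 1 hs
  have hF := hasDerivAt_of_smoothOn hx.isOpen hL.smooth_eulerτ hs
  have hF1 := hasDerivAt_iteratedDeriv hx.isOpen hL.smooth_eulerτ 1 hs
  have hF2 := hasDerivAt_iteratedDeriv hx.isOpen hL.smooth_eulerτ 2 hs
  have h0 : curvature x s ≠ 0 := (hx.pos s hs).ne'
  have hT := hx.hasDerivAt_tangent hs
  have hN := hx.hasDerivAt_normal hs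
  have hB := hx.hasDerivAt_binormal hs
  have hτF : deriv (fun r => 2 * torsion x r * eulerτ L (curvature x) (torsion x) r) s
      = 2 * deriv (torsion x) s * eulerτ L (curvature x) (torsion x) s
        + 2 * torsion x s * deriv (eulerτ L (curvature x) (torsion x)) s :=
    ((hτ.const_mul 2).mul hF).deriv
  rw [iteratedDeriv_one] at hκ1 hE1 hF1
  have u1 := ((hτ.mul hF).sub (hκ.mul hE)).sub hlam.hasDerivAt
  have u2 := hE1.neg.sub ((hτ.div hκ h0).mul hF1)
  have u3 := (((((hasDerivAt_const s (1 : ℝ)).div hκ h0).mul hF2).sub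
    ((hκ1.div (hκ.pow 2) (pow_ne_zero 2 h0)).mul hF1)).add (hκ.mul hF)).sub (hτ.mul hE)
  refine (((u1.smul hT).add (u2.smul hN)).add (u3.smul hB)).congr_deriv ?_
  rw [elX, elY, elZ, hτF]
  ext i
  simp
  field_simp
  ring

/-- Holds off shell and for arbitrary λ: the multiplier enters `momentum` only along T and is killed
by T ×. -/
theorem hasDerivAt_spin (hx : IsFrenetCurve J x)
    (hL : IsRegularAlong L Ω J (curvature x) (torsion x)) (hs : s ∈ J) :
    HasDerivAt (spin L x) (-(tangent x s ⨯₃ momentum L x lam s)) s := by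
  have hκ := hasDerivAt_of_smoothOn hx.isOpen hx.smooth_curvature hs
  have hE := hasDerivAt_of_smoothOn hx.isOpen hL.smooth_eulerκ hs
  have hF := hasDerivAt_of_smoothOn hx.isOpen hL.smooth_eulerτ hs
  have hF1 := hasDerivAt_iteratedDeriv hx.isOpen hL.smooth_eulerτ 1 hs
  have h0 : curvature x s ≠ 0 := (hx.pos s hs).ne'
  have hT := hx.hasDerivAt_tangent hs
  have hN := hx.hasDerivAt_normal hs
  have hB := hx.hasDerivAt_binormal hs
  rw [iteratedDeriv_one] at hF1
  have hTB : tangent x s ⨯₃ binormal x s = -normal x s := by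
    rw [← cross_anticomm, hx.binormal_cross_tangent hs]
  refine (((hF.smul hT).add ((((hasDerivAt_const s (1 : ℝ)).div hκ h0).mul hF1).smul hN)).add
    (hE.smul hB)).congr_deriv ?_
  simp only [momentum, map_add, map_smul, cross_self, ← IsFrenetCurve.binormal_eq, hTB]
  ext i
  simp
  field_simp
  ring

/-- Conservation of linear and angular momentum. -/
theorem exists_adFrame_mulVec_upsilon_eq (hx : IsFrenetCurve J x)
    (hL : IsRegularAlong L Ω J (curvature x) (torsion x)) (hJ : IsPreconnected J)
    (h : SolvesEL L (curvature x) (torsion x) J lam) :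
    ∃ c₁ c₂ : Fin 3 → ℝ, ∀ s ∈ J,
      adFrame x s *ᵥ upsilon L (curvature x) (torsion x) lam s = Sum.elim c₁ c₂ := by
  have hP : ∀ s ∈ J, HasDerivAt (momentum L x lam) 0 s := fun s hs => by
    obtain ⟨e1, e2, e3⟩ := h.2 s hs
    refine (hasDerivAt_momentum hx hL hs
      (h.1.differentiableAt (hx.isOpen.mem_nhds hs))).congr_deriv ?_
    rw [e1, e2, e3]; simp
  -- The orbital term T × P cancels the derivative of the spin, leaving x × P_s = 0.
  have hM : ∀ s ∈ J, HasDerivAt (fun r => x r ⨯₃ momentum L x lam r + spin L x r) 0 s :=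
    fun s hs => by
      refine (((hx.hasDerivAt_curve hs).crossProduct (hP s hs)).add
        (hasDerivAt_spin hx hL hs (lam := lam))).congr_deriv ?_
      simp
  obtain ⟨c₁, hc₁⟩ := hx.isOpen.exists_is_const_of_deriv_eq_zero hJ
    (fun s hs => (hP s hs).differentiableAt.differentiableWithinAt) fun s hs => (hP s hs).deriv
  obtain ⟨c₂, hc₂⟩ := hx.isOpen.exists_is_const_of_deriv_eq_zero hJ
    (fun s hs => (hM s hs).differentiableAt.differentiableWithinAt) fun s hs => (hM s hs).deriv
  exact ⟨c₁, matD *ᵥ c₂, fun s hs => by rw [adFrame_mulVec_upsilon, hc₂ s hs, hc₁ s hs]⟩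

theorem smoothOn_momentum (hx : IsFrenetCurve J x)
    (hL : IsRegularAlong L Ω J (curvature x) (torsion x)) (hlam : ContDiffOn ℝ ∞ lam J) :
    ContDiffOn ℝ ∞ (momentum L x lam) J := by
  have hκ := hx.smooth_curvature
  have h0 : ∀ s ∈ J, curvature x s ≠ 0 := fun s hs => (hx.pos s hs).ne'
  have hE := hL.smooth_eulerκ
  have hF := hL.smooth_eulerτ
  have hF1 := smoothOn_deriv hx.isOpen hF
  exact ((((hx.smooth_torsion.mul hF).sub (hκ.mul hE)).sub hlam).smul hx.smooth_tangent).add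
    (((smoothOn_deriv hx.isOpen hE).neg.sub ((hx.smooth_torsion.div hκ h0).mul hF1)).smul
      hx.smooth_normal) |>.add
    ((((((contDiffOn_const.div hκ h0).mul (smoothOn_iteratedDeriv hx.isOpen hF 2)).sub
      (((smoothOn_deriv hx.isOpen hκ).div (hκ.pow 2) fun s hs => pow_ne_zero 2 (h0 s hs)).mul
        hF1)).add (hκ.mul hF)).sub (hx.smooth_torsion.mul hE)).smul hx.smooth_binormal)

theorem smoothOn_spin (hx : IsFrenetCurve J x)
    (hL : IsRegularAlong L Ω J (curvature x) (torsion x)) : ContDiffOn ℝ ∞ (spin L x) J :=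
  (hL.smooth_eulerτ.smul hx.smooth_tangent).add
    (((contDiffOn_const.div hx.smooth_curvature fun s hs => (hx.pos s hs).ne').mul
      (smoothOn_deriv hx.isOpen hL.smooth_eulerτ)).smul hx.smooth_normal) |>.add
    (hL.smooth_eulerκ.smul hx.smooth_binormal)

end Momentum

/-! ### Variations of a curve -/

/-- The curve `x + ε v`. -/
def family (x v : ℝ → Fin 3 → ℝ) (ε s : ℝ) : Fin 3 → ℝ := x s + ε • v s

@[simp] theorem family_zero (x v : ℝ → Fin 3 → ℝ) : family x v 0 = x := by
  funext s; simp [family]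

/-- The points at which the varied curves are biregular. -/
def biregularSet (J : Set ℝ) (x v : ℝ → Fin 3 → ℝ) : Set (ℝ × ℝ) :=
  {q | q.2 ∈ J ∧ deriv (family x v q.1) q.2 ⨯₃ iteratedDeriv 2 (family x v q.1) q.2 ≠ 0}

section Family

variable {J : Set ℝ} {x v : ℝ → Fin 3 → ℝ} {s : ℝ}

theorem smoothOn_iteratedDeriv_family (hJ : IsOpen J) (hx : ContDiffOn ℝ ∞ x J)
    (hv : ContDiffOn ℝ ∞ v J) (m : ℕ) :
    ContDiffOn ℝ ∞ (fun q : ℝ × ℝ => iteratedDeriv m (family x v q.1) q.2)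
      (Prod.snd ⁻¹' J) := by
  have h1 : ContDiffOn ℝ ∞ (fun q : ℝ × ℝ => family x v q.1 q.2) (Prod.snd ⁻¹' J) :=
    (hx.comp contDiffOn_snd fun _ h => h).add
      (contDiffOn_fst.smul (hv.comp contDiffOn_snd fun _ h => h))
  exact (smoothOn_iterate_partialS (hJ.preimage continuous_snd) h1 m).congr
    fun q _ => (iterate_partialS (fun q : ℝ × ℝ => family x v q.1 q.2) m q).symm

theorem smoothOn_deriv_family (hJ : IsOpen J) (hx : ContDiffOn ℝ ∞ x J)
    (hv : ContDiffOn ℝ ∞ v J) :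
    ContDiffOn ℝ ∞ (fun q : ℝ × ℝ => deriv (family x v q.1) q.2) (Prod.snd ⁻¹' J) := by
  simpa only [iteratedDeriv_one] using smoothOn_iteratedDeriv_family hJ hx hv 1

theorem isOpen_biregularSet (hJ : IsOpen J) (hx : ContDiffOn ℝ ∞ x J)
    (hv : ContDiffOn ℝ ∞ v J) : IsOpen (biregularSet J x v) :=
  ((smoothOn_deriv_family hJ hx hv).crossProduct
    (smoothOn_iteratedDeriv_family hJ hx hv 2)).continuousOn.isOpen_inter_preimage
      (hJ.preimage continuous_snd) isOpen_compl_singleton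

theorem biregularSet_subset : biregularSet J x v ⊆ Prod.snd ⁻¹' J := fun _ h => h.1

theorem deriv_ne_zero_of_mem_biregularSet {q : ℝ × ℝ} (hq : q ∈ biregularSet J x v) :
    deriv (family x v q.1) q.2 ≠ 0 := fun h => hq.2 (by rw [h]; simp)

theorem smoothOn_speed_family (hJ : IsOpen J) (hx : ContDiffOn ℝ ∞ x J)
    (hv : ContDiffOn ℝ ∞ v J) :
    ContDiffOn ℝ ∞ (fun q : ℝ × ℝ => speed (family x v q.1) q.2) (biregularSet J x v) :=
  smoothOn_len ((smoothOn_deriv_family hJ hx hv).mono biregularSet_subset)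
    fun _ hq => deriv_ne_zero_of_mem_biregularSet hq

theorem smoothOn_curvature_family (hJ : IsOpen J) (hx : ContDiffOn ℝ ∞ x J)
    (hv : ContDiffOn ℝ ∞ v J) :
    ContDiffOn ℝ ∞ (fun q : ℝ × ℝ => curvature (family x v q.1) q.2) (biregularSet J x v) :=
  (smoothOn_len (((smoothOn_deriv_family hJ hx hv).crossProduct
    (smoothOn_iteratedDeriv_family hJ hx hv 2)).mono biregularSet_subset) fun _ hq => hq.2).div
    ((smoothOn_speed_family hJ hx hv).pow 3)
    fun _ hq => pow_ne_zero 3 (len_pos (deriv_ne_zero_of_mem_biregularSet hq)).ne'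

theorem smoothOn_torsion_family (hJ : IsOpen J) (hx : ContDiffOn ℝ ∞ x J)
    (hv : ContDiffOn ℝ ∞ v J) :
    ContDiffOn ℝ ∞ (fun q : ℝ × ℝ => torsion (family x v q.1) q.2) (biregularSet J x v) := by
  have h1 := ((smoothOn_deriv_family hJ hx hv).crossProduct
    (smoothOn_iteratedDeriv_family hJ hx hv 2)).mono
      (biregularSet_subset (x := x) (v := v))
  exact (((smoothOn_iteratedDeriv_family hJ hx hv 3).mono biregularSet_subset).dotProduct h1).div
    ((smoothOn_len h1 fun _ hq => hq.2).pow 2)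
    fun _ hq => pow_ne_zero 2 (len_pos hq.2).ne'

/-- The varied curve is affine in ε, hence so is each of its derivatives in s. -/
theorem hasDerivAt_iteratedDeriv_family (hJ : IsOpen J) (hx : ContDiffOn ℝ ∞ x J)
    (hv : ContDiffOn ℝ ∞ v J) (m : ℕ) (hs : s ∈ J) :
    HasDerivAt (fun ε => iteratedDeriv m (family x v ε) s) (iteratedDeriv m v s) 0 := by
  have hm : (m : WithTop ℕ∞) ≤ ∞ := WithTop.coe_le_coe.2 le_top
  have h1 : ∀ ε, iteratedDeriv m (family x v ε) s
      = iteratedDeriv m x s + ε • iteratedDeriv m v s := fun ε => by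
    have hv' := (hv.contDiffAt (hJ.mem_nhds hs)).of_le hm
    have hadd := iteratedDeriv_add ((hx.contDiffAt (hJ.mem_nhds hs)).of_le hm) (hv'.const_smul ε)
    rw [← iteratedDeriv_fun_const_smul hv' ε]
    exact hadd
  simp only [h1]
  simpa using ((hasDerivAt_id (0 : ℝ)).smul_const (iteratedDeriv m v s)).const_add
    (iteratedDeriv m x s)

theorem hasDerivAt_deriv_family (hJ : IsOpen J) (hx : ContDiffOn ℝ ∞ x J)
    (hv : ContDiffOn ℝ ∞ v J) (hs : s ∈ J) :
    HasDerivAt (fun ε => deriv (family x v ε) s) (deriv v s) 0 := by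
  simpa only [iteratedDeriv_one] using hasDerivAt_iteratedDeriv_family hJ hx hv 1 hs

end Family

/-! ### First variations of speed, curvature and torsion -/

/-- First variation of the curvature along `v`. -/
noncomputable def curvatureVariation (x v : ℝ → Fin 3 → ℝ) (s : ℝ) : ℝ :=
  iteratedDeriv 2 v s ⬝ᵥ normal x s - 2 * curvature x s * (deriv v s ⬝ᵥ tangent x s)

/-- First variation of the torsion along `v`. -/
noncomputable def torsionVariation (x v : ℝ → Fin 3 → ℝ) (s : ℝ) : ℝ :=
  iteratedDeriv 3 v s ⬝ᵥ binormal x s / curvature x s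
    - deriv (curvature x) s / curvature x s ^ 2 * (iteratedDeriv 2 v s ⬝ᵥ binormal x s)
    - torsion x s / curvature x s * (iteratedDeriv 2 v s ⬝ᵥ normal x s)
    + curvature x s * (deriv v s ⬝ᵥ binormal x s) - torsion x s * (deriv v s ⬝ᵥ tangent x s)

namespace IsFrenetCurve

variable {J : Set ℝ} {x v : ℝ → Fin 3 → ℝ} {s : ℝ}

theorem mem_biregularSet (h : IsFrenetCurve J x) (hs : s ∈ J) : (0, s) ∈ biregularSet J x v :=
  ⟨hs, by simpa using h.cross_ne_zero hs⟩

theorem hasDerivAt_speed_family (h : IsFrenetCurve J x) (hv : ContDiffOn ℝ ∞ v J) (hs : s ∈ J) :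
    HasDerivAt (fun ε => speed (family x v ε) s) (deriv v s ⬝ᵥ tangent x s) 0 := by
  refine (hasDerivAt_len (hasDerivAt_deriv_family h.isOpen h.smooth hv hs)
    (deriv_ne_zero_of_mem_biregularSet (h.mem_biregularSet hs))).congr_deriv ?_
  rw [family_zero, h.len_tangent hs, div_one]
  rfl

/-- At ε = 0 the vector x_s × x_ss is κB, so only the B-component of its variation changes the
length. -/
theorem hasDerivAt_len_cross_family (h : IsFrenetCurve J x) (hv : ContDiffOn ℝ ∞ v J)
    (hs : s ∈ J) :
    HasDerivAt (fun ε => len (deriv (family x v ε) s ⨯₃ iteratedDeriv 2 (family x v ε) s))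
      (curvature x s * (deriv v s ⬝ᵥ tangent x s) + iteratedDeriv 2 v s ⬝ᵥ normal x s) 0 := by
  have h0 := (h.pos s hs).ne'
  refine (hasDerivAt_len ((hasDerivAt_deriv_family h.isOpen h.smooth hv hs).crossProduct
    (hasDerivAt_iteratedDeriv_family h.isOpen h.smooth hv 2 hs))
    (h.mem_biregularSet hs).2).congr_deriv ?_
  rw [family_zero, ← h.curvature_eq hs, h.cross_eq hs, h.iteratedDeriv_two_eq hs,
    show deriv x s = tangent x s from rfl]
  have e1 : deriv v s ⨯₃ normal x s ⬝ᵥ binormal x s = deriv v s ⬝ᵥ tangent x s := by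
    rw [dotProduct_comm, triple_product_permutation, h.normal_cross_binormal hs]
  have e2 : tangent x s ⨯₃ iteratedDeriv 2 v s ⬝ᵥ binormal x s
      = iteratedDeriv 2 v s ⬝ᵥ normal x s := by
    rw [dotProduct_comm, ← triple_product_permutation, h.binormal_cross_tangent hs]
  simp only [map_smul, add_dotProduct, smul_dotProduct, dotProduct_smul, e1, e2, smul_eq_mul]
  field_simp

theorem hasDerivAt_curvature_family (h : IsFrenetCurve J x) (hv : ContDiffOn ℝ ∞ v J)
    (hs : s ∈ J) :
    HasDerivAt (fun ε => curvature (family x v ε) s) (curvatureVariation x v s) 0 := by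
  have h1 := h.hasDerivAt_speed_family hv hs
  refine ((h.hasDerivAt_len_cross_family hv hs).div (h1.pow 3)
    (by simp [h.speed_eq s hs])).congr_deriv ?_
  rw [curvatureVariation]
  simp only [family_zero, h.speed_eq s hs, ← h.curvature_eq hs]
  simp [h.speed_eq s hs]
  ring

/-- Quotient rule on the general-parameter formula, with x_sss = -κ² T + κ_s N + κτ B at ε = 0; the
triple products with v_s and v_ss are cyclic permutations of frame components. -/
theorem hasDerivAt_torsion_family (h : IsFrenetCurve J x) (hv : ContDiffOn ℝ ∞ v J)
    (hs : s ∈ J) :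
    HasDerivAt (fun ε => torsion (family x v ε) s) (torsionVariation x v s) 0 := by
  have h0 := (h.pos s hs).ne'
  refine (((hasDerivAt_iteratedDeriv_family h.isOpen h.smooth hv 3 hs).dotProduct
    ((hasDerivAt_deriv_family h.isOpen h.smooth hv hs).crossProduct
      (hasDerivAt_iteratedDeriv_family h.isOpen h.smooth hv 2 hs))).div
    ((h.hasDerivAt_len_cross_family hv hs).pow 2)
    (by simpa [← h.curvature_eq hs] using h0)).congr_deriv ?_
  have h3 : iteratedDeriv 3 x s = -curvature x s ^ 2 • tangent x s
      + deriv (curvature x) s • normal x s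
      + (curvature x s * torsion x s) • binormal x s := by
    rw [h.iteratedDeriv_three_eq hs, (h.hasDerivAt_normal hs).deriv]
    module
  have e1 : normal x s ⬝ᵥ deriv v s ⨯₃ normal x s = 0 := dot_cross_self _ _
  have e2 : tangent x s ⬝ᵥ deriv v s ⨯₃ normal x s = -(deriv v s ⬝ᵥ binormal x s) := by
    rw [triple_product_permutation, ← cross_anticomm, ← binormal_eq, dotProduct_neg]
  have e3 : binormal x s ⬝ᵥ deriv v s ⨯₃ normal x s = deriv v s ⬝ᵥ tangent x s := by
    rw [triple_product_permutation, h.normal_cross_binormal hs]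
  have e4 : tangent x s ⬝ᵥ tangent x s ⨯₃ iteratedDeriv 2 v s = 0 := dot_self_cross _ _
  have e5 : normal x s ⬝ᵥ tangent x s ⨯₃ iteratedDeriv 2 v s
      = -(iteratedDeriv 2 v s ⬝ᵥ binormal x s) := by
    rw [← triple_product_permutation, ← cross_anticomm, ← binormal_eq, dotProduct_neg]
  have e6 : binormal x s ⬝ᵥ tangent x s ⨯₃ iteratedDeriv 2 v s
      = iteratedDeriv 2 v s ⬝ᵥ normal x s := by
    rw [← triple_product_permutation, h.binormal_cross_tangent hs]
  have e7 : tangent x s ⬝ᵥ binormal x s = 0 := tangent_dot_binormal x s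
  have e8 : normal x s ⬝ᵥ binormal x s = 0 := normal_dot_binormal x s
  simp only [Pi.pow_apply, family_zero, ← h.curvature_eq hs]
  rw [h.cross_eq hs, h3, h.iteratedDeriv_two_eq hs, show deriv x s = tangent x s from rfl, torsionVariation]
  simp only [map_smul, dotProduct_add, add_dotProduct, smul_dotProduct, dotProduct_smul, e1, e2, e3,
    e4, e5, e6, e7, e8, h.binormal_dot_binormal hs, smul_eq_mul]
  field_simp
  ring

end IsFrenetCurve

/-! ### Prolonged variations -/

section Prolongation

variable {J : Set ℝ} {c d : ℝ} {f e : ℝ → ℝ} {a : ℕ → ℝ → ℝ}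

theorem smoothOn_prolongation (hJ : IsOpen J) (hf : ContDiffOn ℝ ∞ f J) (he : ContDiffOn ℝ ∞ e J)
    (ha : ContDiffOn ℝ ∞ (a 0) J)
    (hrec : ∀ m, ∀ s ∈ J, a (m + 1) s = deriv (a m) s - e s * iteratedDeriv (m + 1) f s) (m : ℕ) :
    ContDiffOn ℝ ∞ (a m) J := by
  induction m with
  | zero => exact ha
  | succ m ih =>
    exact ((smoothOn_deriv hJ ih).sub (he.mul (smoothOn_iteratedDeriv hJ hf (m + 1)))).congr
      (hrec m)

theorem prolongation_eventuallyEq_zero (hJ : IsOpen J) (hc : c ∈ J) (ha : a 0 =ᶠ[𝓝 c] 0)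
    (he : e =ᶠ[𝓝 c] 0)
    (hrec : ∀ m, ∀ s ∈ J, a (m + 1) s = deriv (a m) s - e s * iteratedDeriv (m + 1) f s) (m : ℕ) :
    a m =ᶠ[𝓝 c] 0 := by
  induction m with
  | zero => exact ha
  | succ m ih =>
    filter_upwards [hJ.mem_nhds hc, eventuallyEq_zero_deriv ih, he] with s hs h1 h2
    rw [hrec m s hs, h1, h2]; simp

/-- Integration by parts of the terms of the first variation, up to a total derivative. -/
theorem isTotalDeriv_prolongation (hJ : IsOpen J) (hf : ContDiffOn ℝ ∞ f J)
    (he : ContDiffOn ℝ ∞ e J) (ha : ContDiffOn ℝ ∞ (a 0) J)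
    (hrec : ∀ m, ∀ s ∈ J, a (m + 1) s = deriv (a m) s - e s * iteratedDeriv (m + 1) f s)
    (hc : c ∈ J) (hd : d ∈ J) (hac : a 0 =ᶠ[𝓝 c] 0) (had : a 0 =ᶠ[𝓝 d] 0)
    (hec : e =ᶠ[𝓝 c] 0) (hed : e =ᶠ[𝓝 d] 0) (m : ℕ) {g : ℝ → ℝ} (hg : ContDiffOn ℝ ∞ g J) :
    IsTotalDeriv J c d fun s => g s * a m s - ((-1) ^ m * iteratedDeriv m g s * a 0 s
      - e s * ∑ i ∈ Finset.range m,
        (-1 : ℝ) ^ i * iteratedDeriv i g s * iteratedDeriv (m - i) f s) := by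
  induction m generalizing g with
  | zero => exact IsTotalDeriv.zero.congr fun s _ => by simp
  | succ m ih =>
    have h1 := IsTotalDeriv.deriv_mul_add hJ hg (smoothOn_prolongation hJ hf he ha hrec m)
      (prolongation_eventuallyEq_zero hJ hc hac hec hrec m).eq_of_nhds
      (prolongation_eventuallyEq_zero hJ hd had hed hrec m).eq_of_nhds
    -- By the recursion, g a_{m+1} = (g a_m)_s - g_s a_m - e g f_{m+1}. The induction hypothesis for
    -- g_s handles the middle term, and the last one is the new summand i = 0 of the shifted sum.
    refine (h1.add hJ (ih (smoothOn_deriv hJ hg)).neg).congr fun s hs => ?_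
    rw [hrec m s hs, Finset.sum_range_succ']
    simp only [Nat.add_sub_add_right, iteratedDeriv_succ' (n := m) (f := g), pow_succ, pow_zero,
      iteratedDeriv_zero, Nat.sub_zero]
    have h2 : ∑ i ∈ Finset.range m, (-1 : ℝ) ^ i * -1 * iteratedDeriv (i + 1) g s
          * iteratedDeriv (m - i) f s
        = -∑ i ∈ Finset.range m, (-1 : ℝ) ^ i * iteratedDeriv i (deriv g) s
          * iteratedDeriv (m - i) f s := by
      rw [← Finset.sum_neg_distrib]
      refine Finset.sum_congr rfl fun i _ => ?_
      rw [iteratedDeriv_succ']; ring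
    rw [h2]
    ring

end Prolongation

theorem IsRegularAlong.isTotalDeriv_prolongation {n : ℕ} {L : Jets n → ℝ} {Ω : Set (Jets n)}
    {J : Set ℝ} {κ τ e : ℝ → ℝ} {a b : ℕ → ℝ → ℝ} {c d : ℝ} (h : IsRegularAlong L Ω J κ τ)
    (he : ContDiffOn ℝ ∞ e J) (ha : ContDiffOn ℝ ∞ (a 0) J) (hb : ContDiffOn ℝ ∞ (b 0) J)
    (hreca : ∀ m, ∀ s ∈ J, a (m + 1) s = deriv (a m) s - e s * iteratedDeriv (m + 1) κ s)
    (hrecb : ∀ m, ∀ s ∈ J, b (m + 1) s = deriv (b m) s - e s * iteratedDeriv (m + 1) τ s)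
    (hc : c ∈ J) (hd : d ∈ J) (hac : a 0 =ᶠ[𝓝 c] 0) (had : a 0 =ᶠ[𝓝 d] 0)
    (hbc : b 0 =ᶠ[𝓝 c] 0) (hbd : b 0 =ᶠ[𝓝 d] 0) (hec : e =ᶠ[𝓝 c] 0) (hed : e =ᶠ[𝓝 d] 0) :
    IsTotalDeriv J c d fun s =>
      (∑ m : Fin (n + 1), dLκ L κ τ m s * a m s + ∑ m : Fin (n + 1), dLτ L κ τ m s * b m s)
        - (eulerκ L κ τ s * a 0 s + eulerτ L κ τ s * b 0 s
          - e s * (multiplier L κ τ s - 2 * τ s * eulerτ L κ τ s + L (jet n κ τ s))) := by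
  have h1 := IsTotalDeriv.sum h.isOpen Finset.univ fun (m : Fin (n + 1)) _ =>
    SE3Variational.isTotalDeriv_prolongation h.isOpen h.smooth_fst he ha hreca hc hd hac had hec hed
      m (h.smooth_dLκ m)
  have h2 := IsTotalDeriv.sum h.isOpen Finset.univ fun (m : Fin (n + 1)) _ =>
    SE3Variational.isTotalDeriv_prolongation h.isOpen h.smooth_snd he hb hrecb hc hd hbc hbd hec hed
      m (h.smooth_dLτ m)
  refine (h1.add h.isOpen h2).congr fun s _ => ?_
  -- The coefficient of -e is the pair of double sums, that is, λ₀ with its first two terms 2τE^τ -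
  -- L removed.
  simp only [Finset.sum_sub_distrib, ← Finset.sum_mul, ← Finset.mul_sum, multiplier]
  rw [eulerκ, show eulerτ L κ τ s = _ from rfl, eulerτ]
  ring

/-! ### Reduction of the first variation to the momentum -/

section Reduction

variable {n : ℕ} {L : Jets n → ℝ} {Ω : Set (Jets n)} {J : Set ℝ} {x v : ℝ → Fin 3 → ℝ}
  {lam : ℝ → ℝ} {c d : ℝ}

theorem smoothOn_curvatureVariation (hx : IsFrenetCurve J x) (hv : ContDiffOn ℝ ∞ v J) :
    ContDiffOn ℝ ∞ (curvatureVariation x v) J :=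
  ((smoothOn_iteratedDeriv hx.isOpen hv 2).dotProduct hx.smooth_normal).sub
    ((contDiffOn_const.mul hx.smooth_curvature).mul
      ((smoothOn_deriv hx.isOpen hv).dotProduct hx.smooth_tangent))

theorem smoothOn_torsionVariation (hx : IsFrenetCurve J x) (hv : ContDiffOn ℝ ∞ v J) :
    ContDiffOn ℝ ∞ (torsionVariation x v) J := by
  have h0 : ∀ s ∈ J, curvature x s ≠ 0 := fun s hs => (hx.pos s hs).ne'
  have hκ := hx.smooth_curvature
  have hτ := hx.smooth_torsion
  have h1 := smoothOn_deriv hx.isOpen hv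
  have h2 := smoothOn_iteratedDeriv hx.isOpen hv 2
  have h3 := smoothOn_iteratedDeriv hx.isOpen hv 3
  exact (((((h3.dotProduct hx.smooth_binormal).div hκ h0).sub
    (((smoothOn_deriv hx.isOpen hκ).div (hκ.pow 2) fun s hs => pow_ne_zero 2 (h0 s hs)).mul
      (h2.dotProduct hx.smooth_binormal))).sub
    ((hτ.div hκ h0).mul (h2.dotProduct hx.smooth_normal))).add
    (hκ.mul (h1.dotProduct hx.smooth_binormal))).sub (hτ.mul (h1.dotProduct hx.smooth_tangent))

theorem curvatureVariation_eventuallyEq_zero (hv : v =ᶠ[𝓝 c] 0) :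
    curvatureVariation x v =ᶠ[𝓝 c] 0 := by
  filter_upwards [eventuallyEq_zero_deriv hv, eventuallyEq_zero_iteratedDeriv hv 2] with s h1 h2
  simp [curvatureVariation, h1, h2]

theorem torsionVariation_eventuallyEq_zero (hv : v =ᶠ[𝓝 c] 0) :
    torsionVariation x v =ᶠ[𝓝 c] 0 := by
  filter_upwards [eventuallyEq_zero_deriv hv, eventuallyEq_zero_iteratedDeriv hv 2,
    eventuallyEq_zero_iteratedDeriv hv 3] with s h1 h2 h3
  simp [torsionVariation, h1, h2, h3]

theorem isTotalDeriv_momentum (hx : IsFrenetCurve J x)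
    (hL : IsRegularAlong L Ω J (curvature x) (torsion x)) (hv : ContDiffOn ℝ ∞ v J)
    (hvc : v =ᶠ[𝓝 c] 0) (hvd : v =ᶠ[𝓝 d] 0) :
    IsTotalDeriv J c d fun s =>
      (eulerκ L (curvature x) (torsion x) s * curvatureVariation x v s
        + eulerτ L (curvature x) (torsion x) s * torsionVariation x v s
        - (deriv v s ⬝ᵥ tangent x s)
          * (lam s - 2 * torsion x s * eulerτ L (curvature x) (torsion x) s))
        - momentum L x lam s ⬝ᵥ deriv v s := by
  have h0 : ∀ s ∈ J, curvature x s ≠ 0 := fun s hs => (hx.pos s hs).ne'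
  have hE := hL.smooth_eulerκ
  have hF := hL.smooth_eulerτ
  -- The boundary terms of two integrations by parts. Removing v_sss from (E^τ/κ) v_sss · B produces
  -- terms that cancel those with κ_s and with (τ/κ) v_ss · N in the torsion variation; what remains
  -- of second order is E^κ v_ss · N - (D_s E^τ/κ) v_ss · B, and the other two terms of the
  -- primitive integrate it.
  refine ⟨fun s => eulerτ L (curvature x) (torsion x) s / curvature x s
      * (iteratedDeriv 2 v s ⬝ᵥ binormal x s)
    + (eulerκ L (curvature x) (torsion x) s * (deriv v s ⬝ᵥ normal x s)
    - deriv (eulerτ L (curvature x) (torsion x)) s / curvature x s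
      * (deriv v s ⬝ᵥ binormal x s)), ?_, ?_, ?_, fun s hs => HasDerivAt.deriv ?_⟩
  · have h1 := smoothOn_deriv hx.isOpen hv
    exact ((hF.div hx.smooth_curvature h0).mul
      ((smoothOn_iteratedDeriv hx.isOpen hv 2).dotProduct hx.smooth_binormal)).add
      ((hE.mul (h1.dotProduct hx.smooth_normal)).sub
        (((smoothOn_deriv hx.isOpen hF).div hx.smooth_curvature h0).mul
          (h1.dotProduct hx.smooth_binormal)))
  · simp [(eventuallyEq_zero_deriv hvc).eq_of_nhds,
      (eventuallyEq_zero_iteratedDeriv hvc 2).eq_of_nhds]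
  · simp [(eventuallyEq_zero_deriv hvd).eq_of_nhds,
      (eventuallyEq_zero_iteratedDeriv hvd 2).eq_of_nhds]
  · have hκ := hasDerivAt_of_smoothOn hx.isOpen hx.smooth_curvature hs
    have hE0 := hasDerivAt_of_smoothOn hx.isOpen hE hs
    have hF0 := hasDerivAt_of_smoothOn hx.isOpen hF hs
    have hF1 := hasDerivAt_iteratedDeriv hx.isOpen hF 1 hs
    have hv1 := hasDerivAt_iteratedDeriv hx.isOpen hv 1 hs
    have hv2 := hasDerivAt_iteratedDeriv hx.isOpen hv 2 hs
    have hN := hx.hasDerivAt_normal hs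
    have hB := hx.hasDerivAt_binormal hs
    have hκ0 := h0 s hs
    rw [iteratedDeriv_one] at hF1 hv1
    refine (((hF0.div hκ hκ0).mul (hv2.dotProduct hB)).add
      ((hE0.mul (hv1.dotProduct hN)).sub
        ((hF1.div hκ hκ0).mul (hv1.dotProduct hB)))).congr_deriv ?_
    simp only [Pi.div_apply, momentum, curvatureVariation, torsionVariation, add_dotProduct, dotProduct_add, smul_dotProduct, dotProduct_smul, smul_eq_mul,
      dotProduct_comm (tangent x s) (deriv v s), dotProduct_comm (normal x s) (deriv v s),
      dotProduct_comm (binormal x s) (deriv v s)]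
    field_simp
    ring

theorem isTotalDeriv_eulerLagrange (hx : IsFrenetCurve J x)
    (hL : IsRegularAlong L Ω J (curvature x) (torsion x)) (hlam : ContDiffOn ℝ ∞ lam J)
    (hv : ContDiffOn ℝ ∞ v J) (hvc : v =ᶠ[𝓝 c] 0) (hvd : v =ᶠ[𝓝 d] 0) :
    IsTotalDeriv J c d fun s => momentum L x lam s ⬝ᵥ deriv v s
      - -deriv (momentum L x lam) s ⬝ᵥ v s := by
  have hP := smoothOn_momentum hx hL hlam
  refine ⟨fun s => momentum L x lam s ⬝ᵥ v s, hP.dotProduct hv, ?_, ?_, fun s hs => ?_⟩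
  · simp [hvc.eq_of_nhds]
  · simp [hvd.eq_of_nhds]
  · rw [((hasDerivAt_of_smoothOn hx.isOpen hP hs).dotProduct
      (hasDerivAt_of_smoothOn hx.isOpen hv hs)).deriv]
    simp only [neg_dotProduct]
    ring

theorem neg_deriv_momentum_dotProduct (hx : IsFrenetCurve J x)
    (hL : IsRegularAlong L Ω J (curvature x) (torsion x)) {s : ℝ} (hs : s ∈ J)
    (hlam : DifferentiableAt ℝ lam s) (w : Fin 3 → ℝ) :
    -deriv (momentum L x lam) s ⬝ᵥ w =
      elX L (curvature x) (torsion x) lam s * (w ⬝ᵥ tangent x s)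
        + elY L (curvature x) (torsion x) lam s * (w ⬝ᵥ normal x s)
        + elZ L (curvature x) (torsion x) s * (w ⬝ᵥ binormal x s) := by
  rw [(hasDerivAt_momentum hx hL hs hlam).deriv, neg_neg, dotProduct_comm]
  simp only [dotProduct_add, dotProduct_smul, smul_eq_mul]

end Reduction

/-! ### First variation of Lagrangians -/

section FirstVariation

variable {n : ℕ} {L : Jets n → ℝ} {Ω : Set (Jets n)} {J : Set ℝ} {κ τ : ℝ → ℝ}
  {U : Set (ℝ × ℝ)} {Φ Ψ : ℕ → ℝ × ℝ → ℝ} {s : ℝ}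

/-- The jets with components `Φ m`, `Ψ m`. -/
def jetOf (n : ℕ) (Φ Ψ : ℕ → ℝ × ℝ → ℝ) (q : ℝ × ℝ) : Jets n :=
  (fun m => Φ m q, fun m => Ψ m q)

theorem smoothOn_jetOf (hΦ : ∀ m, ContDiffOn ℝ ∞ (Φ m) U) (hΨ : ∀ m, ContDiffOn ℝ ∞ (Ψ m) U) :
    ContDiffOn ℝ ∞ (jetOf n Φ Ψ) U :=
  (contDiffOn_pi.2 fun m : Fin (n + 1) => hΦ m).prodMk
    (contDiffOn_pi.2 fun m : Fin (n + 1) => hΨ m)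

theorem isOpen_jetOf_domain (hU : IsOpen U) (hΩ : IsOpen Ω) (hΦ : ∀ m, ContDiffOn ℝ ∞ (Φ m) U)
    (hΨ : ∀ m, ContDiffOn ℝ ∞ (Ψ m) U) : IsOpen (U ∩ jetOf n Φ Ψ ⁻¹' Ω) :=
  (smoothOn_jetOf hΦ hΨ).continuousOn.isOpen_inter_preimage hU hΩ

theorem IsRegularAlong.hasDerivAt_jetOf (h : IsRegularAlong L Ω J κ τ) (hU : IsOpen U)
    (hΦ : ∀ m, ContDiffOn ℝ ∞ (Φ m) U) (hΨ : ∀ m, ContDiffOn ℝ ∞ (Ψ m) U) (hs : s ∈ J)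
    (hsU : (0, s) ∈ U) (hjet : jetOf n Φ Ψ (0, s) = jet n κ τ s) :
    HasDerivAt (fun ε => L (jetOf n Φ Ψ (ε, s)))
      (∑ m : Fin (n + 1), dLκ L κ τ m s * partialE (Φ m) (0, s)
        + ∑ m : Fin (n + 1), dLτ L κ τ m s * partialE (Ψ m) (0, s)) 0 := by
  have hj : HasDerivAt (fun ε => jetOf n Φ Ψ (ε, s))
      ((fun m : Fin (n + 1) => partialE (Φ m) (0, s),
        fun m : Fin (n + 1) => partialE (Ψ m) (0, s)) : Jets n) 0 :=
    (hasDerivAt_pi.2 fun m : Fin (n + 1) => hasDerivAt_partialE hU (hΦ m) hsU).prodMk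
      (hasDerivAt_pi.2 fun m : Fin (n + 1) => hasDerivAt_partialE hU (hΨ m) hsU)
  have hL : HasFDerivAt L (fderiv ℝ L (jet n κ τ s)) (jetOf n Φ Ψ (0, s)) := by
    rw [hjet]
    exact ((h.smooth_lagrangian.differentiableOn (by simp)).differentiableAt
      (h.isOpen_domain.mem_nhds (h.jet_mem s hs))).hasFDerivAt
  refine (hL.comp_hasDerivAt 0 hj).congr_deriv ?_
  rw [fderiv_jet_apply]
  rfl

end FirstVariation

/-! ### Iterated weighted derivatives in the curve parameter -/

section Prolong

/-- The iterates of `F ↦ ∂_s F / W`. -/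
noncomputable def prolong (W F : ℝ × ℝ → ℝ) : ℕ → ℝ × ℝ → ℝ
  | 0 => F
  | m + 1 => fun q => partialS (prolong W F m) q / W q

variable {U : Set (ℝ × ℝ)} {J : Set ℝ} {W F : ℝ × ℝ → ℝ} {s : ℝ}

theorem smoothOn_prolong (hU : IsOpen U) (hW : ContDiffOn ℝ ∞ W U) (hW0 : ∀ q ∈ U, W q ≠ 0)
    (hF : ContDiffOn ℝ ∞ F U) (m : ℕ) : ContDiffOn ℝ ∞ (prolong W F m) U := by
  induction m with
  | zero => exact hF
  | succ m ih => exact (smoothOn_partialS hU ih).div hW hW0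

theorem prolong_zero_left {f : ℝ → ℝ} (hJ : IsOpen J) (hF : ∀ s ∈ J, F (0, s) = f s)
    (hW1 : ∀ s ∈ J, W (0, s) = 1) (m : ℕ) (hs : s ∈ J) :
    prolong W F m (0, s) = iteratedDeriv m f s := by
  induction m generalizing s with
  | zero => simpa [prolong] using hF s hs
  | succ m ih =>
    simp only [prolong, hW1 s hs, div_one, iteratedDeriv_succ, partialS]
    exact eqOn_deriv hJ (fun r hr => ih hr) hs

/-- Quotient rule and commuting partials at ε = 0, where W = 1: the variation of the weight produces
the extra term with ∂W/∂ε. -/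
theorem partialE_prolong_succ {f : ℝ → ℝ} (hU : IsOpen U) (hW : ContDiffOn ℝ ∞ W U)
    (hW0 : ∀ q ∈ U, W q ≠ 0) (hF : ContDiffOn ℝ ∞ F U) (hJ : IsOpen J)
    (hJU : ∀ s ∈ J, ((0 : ℝ), s) ∈ U) (hf : ∀ s ∈ J, F (0, s) = f s)
    (hW1 : ∀ s ∈ J, W (0, s) = 1) (m : ℕ) (hs : s ∈ J) :
    partialE (prolong W F (m + 1)) (0, s)
      = deriv (fun r => partialE (prolong W F m) (0, r)) s
        - partialE W (0, s) * iteratedDeriv (m + 1) f s := by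
  have hm := smoothOn_prolong hU hW hW0 hF m
  have h1 := hasDerivAt_partialE hU (smoothOn_partialS hU hm) (hJU s hs)
  have h2 := hasDerivAt_partialE hU hW (hJU s hs)
  have h3 := (h1.div h2 (hW0 _ (hJU s hs))).deriv
  rw [partialE_partialS hU hm (hJU s hs)] at h3
  have h4 : partialS (prolong W F m) (0, s) = iteratedDeriv (m + 1) f s := by
    simp only [← prolong_zero_left hJ hf hW1 (m + 1) hs, prolong, hW1 s hs, div_one]
  simp only [h4, hW1 s hs] at h3
  refine h3.trans ?_
  rw [partialS]
  ring

end Prolong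

/-! ### First variation of the two functionals -/

section Functionals

variable {n : ℕ} {L : Jets n → ℝ} {Ω : Set (Jets n)} {J : Set ℝ} {x v : ℝ → Fin 3 → ℝ}
  {c d : ℝ} {U : Set (ℝ × ℝ)} {W : ℝ × ℝ → ℝ}

/-- The curvature of the varied curves. -/
noncomputable def familyCurvature (x v : ℝ → Fin 3 → ℝ) (q : ℝ × ℝ) : ℝ :=
  curvature (family x v q.1) q.2

/-- The torsion of the varied curves. -/
noncomputable def familyTorsion (x v : ℝ → Fin 3 → ℝ) (q : ℝ × ℝ) : ℝ :=
  torsion (family x v q.1) q.2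

/-- The speed of the varied curves. -/
noncomputable def familySpeed (x v : ℝ → Fin 3 → ℝ) (q : ℝ × ℝ) : ℝ :=
  speed (family x v q.1) q.2

/-- The jets of curvature and torsion of the varied curves with respect to `∂_s / W`. -/
noncomputable def familyJet (n : ℕ) (x v : ℝ → Fin 3 → ℝ) (W : ℝ × ℝ → ℝ) : ℝ × ℝ → Jets n :=
  jetOf n (prolong W (familyCurvature x v)) (prolong W (familyTorsion x v))

/-- Together with `arcJet_family`, this brings both functionals under `hasDerivAt_action`: weight 1
gives derivatives in the fixed parameter, weight η those in arc length. -/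
theorem jet_family (n : ℕ) (x v : ℝ → Fin 3 → ℝ) (ε s : ℝ) :
    jet n (curvature (family x v ε)) (torsion (family x v ε)) s
      = familyJet n x v (fun _ => 1) (ε, s) := by
  have h : ∀ (F : ℝ × ℝ → ℝ) (m : ℕ) (r : ℝ), iteratedDeriv m (fun r => F (ε, r)) r
      = prolong (fun _ => 1) F m (ε, r) := by
    intro F m
    induction m with
    | zero => simp [prolong]
    | succ m ih => intro r; simp only [iteratedDeriv_succ, prolong, partialS, div_one, funext ih]
  exact Prod.ext (funext fun m => h (familyCurvature x v) m s)
    (funext fun m => h (familyTorsion x v) m s)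

theorem arcJet_family (n : ℕ) (x v : ℝ → Fin 3 → ℝ) (ε s : ℝ) :
    arcJet n (family x v ε) s = familyJet n x v (familySpeed x v) (ε, s) := by
  have h : ∀ (F : ℝ × ℝ → ℝ) (m : ℕ) (r : ℝ), (arcDeriv (family x v ε))^[m] (fun r => F (ε, r)) r
      = prolong (familySpeed x v) F m (ε, r) := by
    intro F m
    induction m with
    | zero => simp [prolong]
    | succ m ih =>
      intro r
      rw [Function.iterate_succ_apply', funext ih]
      rfl
  exact Prod.ext (funext fun m => h (familyCurvature x v) m s)
    (funext fun m => h (familyTorsion x v) m s)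

theorem familyJet_zero (hx : IsFrenetCurve J x) (hW1 : ∀ s ∈ J, W (0, s) = 1) {s : ℝ}
    (hs : s ∈ J) : familyJet n x v W (0, s) = jet n (curvature x) (torsion x) s :=
  Prod.ext (funext fun m => prolong_zero_left hx.isOpen (fun s _ => by simp [familyCurvature])
      hW1 m hs)
    (funext fun m => prolong_zero_left hx.isOpen (fun s _ => by simp [familyTorsion]) hW1 m hs)

theorem eventuallyEq_zero_of_tsupport_subset (hv : tsupport v ⊆ Ioo c d) :
    v =ᶠ[𝓝 c] 0 ∧ v =ᶠ[𝓝 d] 0 :=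
  ⟨notMem_tsupport_iff_eventuallyEq.1 fun h => lt_irrefl _ (hv h).1,
    notMem_tsupport_iff_eventuallyEq.1 fun h => lt_irrefl _ (hv h).2⟩

theorem smoothOn_slice {F : ℝ × ℝ → ℝ} (hF : ContDiffOn ℝ ∞ F U)
    (hJU : ∀ s ∈ J, ((0 : ℝ), s) ∈ U) : ContDiffOn ℝ ∞ (fun s => F (0, s)) J :=
  hF.comp (contDiffOn_const.prodMk contDiffOn_id) hJU

/-- The first variation of an action with integrand `F`, given pointwise, reduced to the momentum. -/
theorem hasDerivAt_action (hx : IsFrenetCurve J x)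
    (hL : IsRegularAlong L Ω J (curvature x) (torsion x)) (hv : ContDiff ℝ ∞ v)
    (hc : c ≤ d) (hsub : Icc c d ⊆ J) (hsupp : tsupport v ⊆ Ioo c d)
    {lam e : ℝ → ℝ} (hlam : ContDiffOn ℝ ∞ lam J)
    (hW : ContDiffOn ℝ ∞ W (biregularSet J x v)) (hW0 : ∀ q ∈ biregularSet J x v, W q ≠ 0)
    (hW1 : ∀ s ∈ J, W (0, s) = 1) (he : ∀ s ∈ J, partialE W (0, s) = e s)
    (hec : e =ᶠ[𝓝 c] 0) (hed : e =ᶠ[𝓝 d] 0)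
    {F : ℝ × ℝ → ℝ}
    (hF : ContDiffOn ℝ ∞ F (biregularSet J x v ∩ familyJet n x v W ⁻¹' Ω))
    (hderiv : ∀ s ∈ J, ∀ ℓ, HasDerivAt (fun ε => L (familyJet n x v W (ε, s))) ℓ 0 →
      partialE F (0, s) = ℓ - (deriv v s ⬝ᵥ tangent x s)
          * (lam s - 2 * torsion x s * eulerτ L (curvature x) (torsion x) s)
        + e s * (multiplier L (curvature x) (torsion x) s
          - 2 * torsion x s * eulerτ L (curvature x) (torsion x) s
          + L (jet n (curvature x) (torsion x) s))) :
    HasDerivAt (fun ε => ∫ s in c..d, F (ε, s))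
      (∫ s in c..d, momentum L x lam s ⬝ᵥ deriv v s) 0 := by
  have hJ := hx.isOpen
  have hvJ : ContDiffOn ℝ ∞ v J := hv.contDiffOn
  obtain ⟨hvc, hvd⟩ := eventuallyEq_zero_of_tsupport_subset hsupp
  have hcJ : c ∈ J := hsub (left_mem_Icc.2 hc)
  have hdJ : d ∈ J := hsub (right_mem_Icc.2 hc)
  have hU := isOpen_biregularSet hJ hx.smooth hvJ
  have hJU : ∀ s ∈ J, ((0 : ℝ), s) ∈ biregularSet J x v := fun s hs => hx.mem_biregularSet hs
  have hK : ContDiffOn ℝ ∞ (familyCurvature x v) (biregularSet J x v) :=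
    smoothOn_curvature_family hJ hx.smooth hvJ
  have hT : ContDiffOn ℝ ∞ (familyTorsion x v) (biregularSet J x v) :=
    smoothOn_torsion_family hJ hx.smooth hvJ
  have hΦ := smoothOn_prolong hU hW hW0 hK
  have hΨ := smoothOn_prolong hU hW hW0 hT
  -- For ε ≠ 0 the integrand is controlled only where the varied curve is biregular and its jet
  -- stays in Ω; this set is open and contains {0} × J.
  have hV := isOpen_jetOf_domain (n := n) hU hL.isOpen_domain hΦ hΨ
  have hJV : ∀ s ∈ J, ((0 : ℝ), s) ∈ biregularSet J x v ∩ familyJet n x v W ⁻¹' Ω := fun s hs =>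
    ⟨hJU s hs, by rw [mem_preimage, familyJet_zero hx hW1 hs]; exact hL.jet_mem s hs⟩
  have ha : EqOn (fun s => partialE (prolong W (familyCurvature x v) 0) (0, s))
      (curvatureVariation x v) J := fun s hs => (hx.hasDerivAt_curvature_family hvJ hs).deriv
  have hb : EqOn (fun s => partialE (prolong W (familyTorsion x v) 0) (0, s))
      (torsionVariation x v) J := fun s hs => (hx.hasDerivAt_torsion_family hvJ hs).deriv
  have hes : ContDiffOn ℝ ∞ e J :=
    (smoothOn_slice (smoothOn_partialE hU hW) hJU).congr fun s hs => (he s hs).symm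
  have hprol := hL.isTotalDeriv_prolongation (c := c) (d := d)
    (a := fun m s => partialE (prolong W (familyCurvature x v) m) (0, s))
    (b := fun m s => partialE (prolong W (familyTorsion x v) m) (0, s)) hes
    ((smoothOn_curvatureVariation hx hvJ).congr ha) ((smoothOn_torsionVariation hx hvJ).congr hb)
    (fun m s hs => by
      rw [← he s hs]
      exact partialE_prolong_succ hU hW hW0 hK hJ hJU (fun s _ => by simp [familyCurvature])
        hW1 m hs)
    (fun m s hs => by
      rw [← he s hs]
      exact partialE_prolong_succ hU hW hW0 hT hJ hJU (fun s _ => by simp [familyTorsion])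
        hW1 m hs) hcJ hdJ
    ((ha.eventuallyEq_of_mem (hJ.mem_nhds hcJ)).trans (curvatureVariation_eventuallyEq_zero hvc))
    ((ha.eventuallyEq_of_mem (hJ.mem_nhds hdJ)).trans (curvatureVariation_eventuallyEq_zero hvd))
    ((hb.eventuallyEq_of_mem (hJ.mem_nhds hcJ)).trans (torsionVariation_eventuallyEq_zero hvc))
    ((hb.eventuallyEq_of_mem (hJ.mem_nhds hdJ)).trans (torsionVariation_eventuallyEq_zero hvd))
    hec hed
  -- In `hderiv` the e-term is chosen to cancel the one left by the prolongation, so what remains is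
  -- the left part of `isTotalDeriv_momentum`.
  have htot : IsTotalDeriv J c d fun s => partialE F (0, s)
      - momentum L x lam s ⬝ᵥ deriv v s := by
    refine (hprol.add hJ (isTotalDeriv_momentum (lam := lam) hx hL hvJ hvc hvd)).congr
      fun s hs => ?_
    rw [hderiv s hs _ (hL.hasDerivAt_jetOf hU hΦ hΨ hs (hJU s hs) (familyJet_zero hx hW1 hs))]
    have ha' := ha hs
    have hb' := hb hs
    dsimp only at ha' hb' ⊢
    rw [ha', hb']
    ring
  refine (hasDerivAt_integral_of_smoothOn hV hF hc fun s hs => hJV s (hsub hs)).congr_deriv ?_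
  exact htot.integral_eq hJ hc hsub (smoothOn_slice (smoothOn_partialE hV hF) hJV).continuousOn
    ((smoothOn_momentum hx hL hlam).dotProduct (smoothOn_deriv hJ hvJ)).continuousOn

theorem smoothOn_lagrangian_familyJet (hx : IsFrenetCurve J x)
    (hL : IsRegularAlong L Ω J (curvature x) (torsion x)) (hv : ContDiffOn ℝ ∞ v J)
    (hW : ContDiffOn ℝ ∞ W (biregularSet J x v)) (hW0 : ∀ q ∈ biregularSet J x v, W q ≠ 0) :
    ContDiffOn ℝ ∞ (fun q => L (familyJet n x v W q))
      (biregularSet J x v ∩ familyJet n x v W ⁻¹' Ω) := by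
  have hU := isOpen_biregularSet hx.isOpen hx.smooth hv
  have hj : ContDiffOn ℝ ∞ (familyJet n x v W) (biregularSet J x v) := smoothOn_jetOf
    (smoothOn_prolong hU hW hW0 (smoothOn_curvature_family hx.isOpen hx.smooth hv))
    (smoothOn_prolong hU hW hW0 (smoothOn_torsion_family hx.isOpen hx.smooth hv))
  exact hL.smooth_lagrangian.comp (hj.mono inter_subset_left) fun _ hq => hq.2

theorem hasDerivAt_constrainedAction (hx : IsFrenetCurve J x)
    (hL : IsRegularAlong L Ω J (curvature x) (torsion x)) (hv : ContDiff ℝ ∞ v)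
    (hc : c ≤ d) (hsub : Icc c d ⊆ J) (hsupp : tsupport v ⊆ Ioo c d)
    {μ lam : ℝ → ℝ} (hμ : ContDiffOn ℝ ∞ μ J)
    (hlam : lam = fun s => μ s + 2 * torsion x s * eulerτ L (curvature x) (torsion x) s) :
    HasDerivAt (fun ε => constrainedAction L μ c d (family x v ε))
      (∫ s in c..d, momentum L x lam s ⬝ᵥ deriv v s) 0 := by
  have hvJ : ContDiffOn ℝ ∞ v J := hv.contDiffOn
  have hlams : ContDiffOn ℝ ∞ lam J := by
    rw [hlam]
    exact hμ.add ((contDiffOn_const.mul hL.smooth_snd).mul hL.smooth_eulerτ)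
  simp only [constrainedAction, jet_family]
  -- The weight does not vary, so e = 0 and `multiplier` drops out; μ = λ - 2τE^τ comes from the
  -- constraint term.
  refine hasDerivAt_action (W := fun _ => 1) (e := fun _ => 0)
    (F := fun q => L (familyJet n x v (fun _ => 1) q) - μ q.2 * (familySpeed x v q - 1))
    hx hL hv hc hsub hsupp hlams contDiffOn_const (fun _ _ => one_ne_zero) (fun _ _ => rfl)
    (fun _ _ => by simp [partialE]) (.of_forall fun _ => rfl) (.of_forall fun _ => rfl) ?_ ?_
  · refine (smoothOn_lagrangian_familyJet hx hL hvJ contDiffOn_const fun _ _ => one_ne_zero).sub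
      (((hμ.comp contDiffOn_snd fun q hq => hq.1.1)).mul
        (((smoothOn_speed_family hx.isOpen hx.smooth hvJ).mono inter_subset_left).sub
          contDiffOn_const))
  · intro s hs ℓ hℓ
    refine (hℓ.sub (((hx.hasDerivAt_speed_family hvJ hs).sub_const 1).const_mul
      (μ s))).deriv.trans ?_
    rw [hlam]
    ring

theorem hasDerivAt_arcAction (hx : IsFrenetCurve J x)
    (hL : IsRegularAlong L Ω J (curvature x) (torsion x)) (hv : ContDiff ℝ ∞ v)
    (hc : c ≤ d) (hsub : Icc c d ⊆ J) (hsupp : tsupport v ⊆ Ioo c d) :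
    HasDerivAt (fun ε => arcAction L c d (family x v ε))
      (∫ s in c..d,
        momentum L x (multiplier L (curvature x) (torsion x)) s ⬝ᵥ deriv v s) 0 := by
  have hvJ : ContDiffOn ℝ ∞ v J := hv.contDiffOn
  obtain ⟨hvc, hvd⟩ := eventuallyEq_zero_of_tsupport_subset hsupp
  have hW : ContDiffOn ℝ ∞ (familySpeed x v) (biregularSet J x v) :=
    smoothOn_speed_family hx.isOpen hx.smooth hvJ
  have hW0 : ∀ q ∈ biregularSet J x v, familySpeed x v q ≠ 0 := fun _ hq =>
    (len_pos (deriv_ne_zero_of_mem_biregularSet hq)).ne'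
  have hW1 : ∀ s ∈ J, familySpeed x v (0, s) = 1 := fun s hs => by
    simpa [familySpeed] using hx.speed_eq s hs
  have hzero : ∀ {r : ℝ}, v =ᶠ[𝓝 r] 0 → (fun s => deriv v s ⬝ᵥ tangent x s) =ᶠ[𝓝 r] 0 :=
    fun h => (eventuallyEq_zero_deriv h).mono fun s hs => by simp [hs]
  simp only [arcAction, arcJet_family]
  -- Here e equals the variation v_s · T of the speed, so with λ = λ₀ the two correction terms in
  -- `hderiv` add up to e L, the variation of the length element.
  refine hasDerivAt_action (W := familySpeed x v) (e := fun s => deriv v s ⬝ᵥ tangent x s)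
    (F := fun q => L (familyJet n x v (familySpeed x v) q) * familySpeed x v q)
    hx hL hv hc hsub hsupp hL.smooth_multiplier hW hW0 hW1
    (fun s hs => (hx.hasDerivAt_speed_family hvJ hs).deriv) (hzero hvc) (hzero hvd) ?_ ?_
  · exact (smoothOn_lagrangian_familyJet hx hL hvJ hW hW0).mul (hW.mono inter_subset_left)
  · intro s hs ℓ hℓ
    refine (hℓ.mul (hx.hasDerivAt_speed_family hvJ hs)).deriv.trans ?_
    rw [familyJet_zero hx hW1 hs, family_zero, hx.speed_eq s hs]
    ring

end Functionals

/-! ### Extremals -/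

/-- Fundamental lemma of the calculus of variations for vector-valued functions. -/
theorem eq_zero_of_forall_integral_dotProduct_eq_zero {J : Set ℝ} (hJ : IsOpen J)
    {R : ℝ → Fin 3 → ℝ} (hR : ContinuousOn R J)
    (h : ∀ c d : ℝ, c < d → Icc c d ⊆ J → ∀ v : ℝ → Fin 3 → ℝ, ContDiff ℝ ∞ v →
      tsupport v ⊆ Ioo c d → ∫ s in c..d, R s ⬝ᵥ v s = 0) :
    ∀ s ∈ J, R s = 0 := by
  intro s hs
  obtain ⟨δ, hδ, hsub⟩ := Metric.nhds_basis_closedBall.mem_iff.1 (hJ.mem_nhds hs)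
  rw [Real.closedBall_eq_Icc] at hsub
  have hcd : s - δ < s + δ := by linarith
  ext i
  have hRi : ContinuousOn (fun r => R r i) (Ioo (s - δ) (s + δ)) :=
    ((continuousOn_pi.1 hR i).mono hsub).mono Ioo_subset_Icc_self
  -- Testing with g times the i-th basis vector reduces to the scalar fundamental lemma on a small
  -- interval about s; it gives vanishing almost everywhere, and continuity upgrades this to every
  -- point.
  have hae := isOpen_Ioo.ae_eq_zero_of_integral_contDiff_smul_eq_zero (μ := MeasureTheory.volume)
    (hRi.locallyIntegrableOn measurableSet_Ioo) (fun g hg _ hsupp => by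
      have hsupp' : tsupport (fun r => g r • (Pi.single i 1 : Fin 3 → ℝ))
          ⊆ Ioo (s - δ) (s + δ) :=
        (closure_mono (Function.support_smul_subset_left g _)).trans hsupp
      have h1 := h _ _ hcd hsub (fun r => g r • (Pi.single i 1 : Fin 3 → ℝ))
        (hg.smul contDiff_const) hsupp'
      simp only [dotProduct_smul, dotProduct_single, mul_one] at h1
      rw [intervalIntegral.integral_of_le hcd.le] at h1
      rw [← h1, MeasureTheory.setIntegral_eq_integral_of_forall_compl_eq_zero]
      intro r hr
      have : g r = 0 := by
        by_contra h0
        exact hr (Ioo_subset_Ioc_self (hsupp (subset_tsupport g h0)))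
      simp [this])
  have hEq := MeasureTheory.Measure.eqOn_open_of_ae_eq (μ := MeasureTheory.volume)
    (f := fun r => R r i) (g := fun _ => 0)
    ((MeasureTheory.ae_restrict_iff' measurableSet_Ioo).2 hae) isOpen_Ioo hRi continuousOn_const
  exact hEq ⟨by linarith, by linarith⟩

section Extremal

variable {n : ℕ} {L : Jets n → ℝ} {Ω : Set (Jets n)} {J : Set ℝ} {x : ℝ → Fin 3 → ℝ}
  {lam : ℝ → ℝ} {A : ℝ → ℝ → (ℝ → Fin 3 → ℝ) → ℝ}

theorem integral_momentum_dotProduct (hx : IsFrenetCurve J x)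
    (hL : IsRegularAlong L Ω J (curvature x) (torsion x)) (hlam : ContDiffOn ℝ ∞ lam J)
    {c d : ℝ} (hc : c ≤ d) (hsub : Icc c d ⊆ J) {v : ℝ → Fin 3 → ℝ} (hv : ContDiff ℝ ∞ v)
    (hsupp : tsupport v ⊆ Ioo c d) :
    ∫ s in c..d, momentum L x lam s ⬝ᵥ deriv v s
      = ∫ s in c..d, -deriv (momentum L x lam) s ⬝ᵥ v s := by
  have hP := smoothOn_momentum hx hL hlam
  obtain ⟨hvc, hvd⟩ := eventuallyEq_zero_of_tsupport_subset hsupp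
  exact (isTotalDeriv_eulerLagrange hx hL hlam hv.contDiffOn hvc hvd).integral_eq hx.isOpen hc hsub
    (hP.dotProduct (smoothOn_deriv hx.isOpen hv.contDiffOn)).continuousOn
    ((smoothOn_deriv hx.isOpen hP).neg.dotProduct hv.contDiffOn).continuousOn

/-- A curve is an extremal if and only if the Euler–Lagrange equations hold, for an action whose
first variation is given by the momentum. -/
theorem isExtremal_iff (hx : IsFrenetCurve J x)
    (hL : IsRegularAlong L Ω J (curvature x) (torsion x)) (hlam : ContDiffOn ℝ ∞ lam J)
    (hA : ∀ c d : ℝ, c < d → Icc c d ⊆ J → ∀ v : ℝ → Fin 3 → ℝ, ContDiff ℝ ∞ v →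
      tsupport v ⊆ Ioo c d → HasDerivAt (fun ε => A c d (family x v ε))
        (∫ s in c..d, momentum L x lam s ⬝ᵥ deriv v s) 0) :
    IsExtremal A J x ↔ SolvesEL L (curvature x) (torsion x) J lam := by
  have hd : ∀ s ∈ J, DifferentiableAt ℝ lam s := fun s hs =>
    (hasDerivAt_of_smoothOn hx.isOpen hlam hs).differentiableAt
  have hEL := fun s hs => neg_deriv_momentum_dotProduct hx hL (s := s) hs (hd s hs)
  constructor
  · intro h
    have h0 := eq_zero_of_forall_integral_dotProduct_eq_zero hx.isOpen
      (smoothOn_deriv hx.isOpen (smoothOn_momentum hx hL hlam)).neg.continuousOn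
      fun c d hcd hsub v hv hsupp => by
        rw [← integral_momentum_dotProduct hx hL hlam hcd.le hsub hv hsupp]
        exact (hA c d hcd hsub v hv hsupp).unique (h c d hcd hsub v hv hsupp)
    refine ⟨hlam.differentiableOn (by simp), fun s hs => ?_⟩
    have h1 := hEL s hs
    have hTN := hx.tangent_dot_normal hs
    have hTB := IsFrenetCurve.tangent_dot_binormal x s
    have hNB := IsFrenetCurve.normal_dot_binormal x s
    rw [h0 s hs] at h1
    have eT := h1 (tangent x s)
    have eN := h1 (normal x s)
    have eB := h1 (binormal x s)
    rw [zero_dotProduct, hx.tangent_dot_tangent hs, hTN, hTB] at eT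
    rw [zero_dotProduct, dotProduct_comm _ (tangent x s), hx.normal_dot_normal hs, hTN, hNB] at eN
    rw [zero_dotProduct, dotProduct_comm _ (tangent x s), dotProduct_comm _ (normal x s),
      hx.binormal_dot_binormal hs, hTB, hNB] at eB
    exact ⟨by linarith, by linarith, by linarith⟩
  · intro h c d hcd hsub v hv hsupp
    refine (hA c d hcd hsub v hv hsupp).congr_deriv ?_
    rw [integral_momentum_dotProduct hx hL hlam hcd.le hsub hv hsupp]
    refine (intervalIntegral.integral_congr (g := fun _ => 0) fun s hs => ?_).trans (by simp)
    rw [uIcc_of_le hcd.le] at hs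
    obtain ⟨e1, e2, e3⟩ := h.2 s (hsub hs)
    dsimp only
    rw [hEL s (hsub hs), e1, e2, e3]
    ring

end Extremal

/-! ### Noether currents -/

section Noether

variable {n : ℕ} {L : Jets n → ℝ} {Ω : Set (Jets n)} {J : Set ℝ} {x : ℝ → Fin 3 → ℝ}
  {lam : ℝ → ℝ} {c d : ℝ}

theorem smoothOn_generator (hx : ContDiffOn ℝ ∞ x J) (j : Fin 3 ⊕ Fin 3) :
    ContDiffOn ℝ ∞ (fun s => generator j (x s)) J := by
  have h := contDiffOn_pi.1 hx
  rcases j with i | i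
  · exact contDiffOn_const
  · rw [contDiffOn_pi]
    intro k
    fin_cases i <;> fin_cases k <;>
      first
        | exact contDiffOn_const
        | exact h _
        | exact (h _).neg

/-- The sign in D appears because x∂_z - z∂_x is the negative of the standard rotation field about
the second axis. -/
theorem generator_dotProduct (i : Fin 3) (u P : Fin 3 → ℝ) :
    P ⬝ᵥ generator (Sum.inr i) u = (matD *ᵥ (u ⨯₃ P)) i := by
  fin_cases i <;>
    simp [generator, matD, Matrix.mulVec_diagonal, cross_apply, dotProduct, Fin.sum_univ_three] <;>
    ring

/-- The rotation fields are linear in the point, so `generator_dotProduct` is differentiated along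
the curve with P frozen. -/
theorem dotProduct_deriv_generator (hJ : IsOpen J) (hx : ContDiffOn ℝ ∞ x J) (i : Fin 3)
    (P : Fin 3 → ℝ) {s : ℝ} (hs : s ∈ J) :
    P ⬝ᵥ deriv (fun s => generator (Sum.inr i) (x s)) s = (matD *ᵥ (deriv x s ⨯₃ P)) i := by
  have h1 := (hasDerivAt_const s P).dotProduct
    (hasDerivAt_of_smoothOn hJ (smoothOn_generator hx (Sum.inr i)) hs)
  have h2 := hasDerivAt_pi.1
    ((hasDerivAt_of_smoothOn hJ hx hs).crossProduct (hasDerivAt_const s P)) i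
  simp only [generator_dotProduct] at h1
  have h3 := h1.unique ((h2.const_mul ((![1, -1, 1] : Fin 3 → ℝ) i)).congr_of_eventuallyEq
    (.of_forall fun r => by simp [matD, Matrix.mulVec_diagonal]))
  simpa [matD, Matrix.mulVec_diagonal] using h3

/-- Generators along x are smooth only on J; the cut-off φ makes them globally smooth variations. -/
theorem contDiff_smul_of_tsupport_subset (hJ : IsOpen J) {φ : ℝ → ℝ} (hφ : ContDiff ℝ ∞ φ)
    (hsupp : tsupport φ ⊆ J) {w : ℝ → Fin 3 → ℝ} (hw : ContDiffOn ℝ ∞ w J) :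
    ContDiff ℝ ∞ fun s => φ s • w s := by
  rw [contDiff_iff_contDiffAt]
  intro s
  by_cases hs : s ∈ tsupport φ
  · exact hφ.contDiffAt.smul (hw.contDiffAt (hJ.mem_nhds (hsupp hs)))
  · refine (contDiffAt_const (c := (0 : Fin 3 → ℝ))).congr_of_eventuallyEq ?_
    filter_upwards [notMem_tsupport_iff_eventuallyEq.1 hs] with r hr
    simp [hr]

theorem integral_momentum_generator (hx : IsFrenetCurve J x)
    (hL : IsRegularAlong L Ω J (curvature x) (torsion x)) (hlam : ContDiffOn ℝ ∞ lam J)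
    (hc : c ≤ d) (hsub : Icc c d ⊆ J) {φ : ℝ → ℝ} (hφ : ContDiff ℝ ∞ φ)
    (hsupp : tsupport φ ⊆ Ioo c d) (j : Fin 3 ⊕ Fin 3) :
    ∫ s in c..d, momentum L x lam s ⬝ᵥ deriv (fun s => φ s • generator j (x s)) s
      = ∫ s in c..d, deriv φ s
        * (adFrame x s *ᵥ upsilon L (curvature x) (torsion x) lam s) j := by
  have hP := smoothOn_momentum hx hL hlam
  have hG := smoothOn_generator hx.smooth j
  have hφJ : ContDiffOn ℝ ∞ φ J := hφ.contDiffOn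
  have hd : ∀ s ∈ J, deriv (fun s => φ s • generator j (x s)) s
      = φ s • deriv (fun s => generator j (x s)) s + deriv φ s • generator j (x s) :=
    fun s hs => ((hasDerivAt_of_smoothOn hx.isOpen hφJ hs).smul
      (hasDerivAt_of_smoothOn hx.isOpen hG hs)).deriv
  simp only [adFrame_mulVec_upsilon]
  rcases j with i | i
  · refine intervalIntegral.integral_congr fun s hs => ?_
    rw [uIcc_of_le hc] at hs
    rw [hd s (hsub hs)]
    simp [generator]
  · have hQ : ContDiffOn ℝ ∞ (fun s => spin L x s i) J :=
      contDiffOn_pi.1 (smoothOn_spin hx hL) i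
    have hφc : φ c = 0 := image_eq_zero_of_notMem_tsupport fun h => lt_irrefl _ (hsupp h).1
    have hφd : φ d = 0 := image_eq_zero_of_notMem_tsupport fun h => lt_irrefl _ (hsupp h).2
    have hM : ContDiffOn ℝ ∞
        (fun s => (matD *ᵥ (x s ⨯₃ momentum L x lam s + spin L x s)) i) J := by
      simp only [matD, Matrix.mulVec_diagonal]
      exact contDiffOn_const.mul
        (contDiffOn_pi.1 ((hx.smooth.crossProduct hP).add (smoothOn_spin hx hL)) i)
    have htot : IsTotalDeriv J c d fun s =>
        momentum L x lam s ⬝ᵥ deriv (fun s => φ s • generator (Sum.inr i) (x s)) s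
          - deriv φ s * (matD *ᵥ (x s ⨯₃ momentum L x lam s + spin L x s)) i := by
      -- For a rotation the integrand is φ_s D(x × P) + φ D(T × P), and T × P = -S_s; subtracting
      -- the total derivative of -φ D S turns the second term into φ_s D S.
      have h1 := (IsTotalDeriv.deriv_mul_add hx.isOpen
        (contDiffOn_const (c := (![1, -1, 1] : Fin 3 → ℝ) i).mul hQ) hφJ hφc hφd).neg
      refine h1.congr fun s hs => ?_
      have h2 := ((hasDerivAt_pi.1 (hasDerivAt_spin (lam := lam) hx hL hs) i).const_mul
        ((![1, -1, 1] : Fin 3 → ℝ) i)).deriv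
      rw [h2, hd s hs, dotProduct_add, dotProduct_smul, dotProduct_smul,
        dotProduct_deriv_generator hx.isOpen hx.smooth i _ hs, generator_dotProduct]
      simp only [matD, Matrix.mulVec_diagonal, tangent, smul_eq_mul, Pi.add_apply, Pi.neg_apply]
      ring
    refine htot.integral_eq hx.isOpen hc hsub ?_ ?_
    · refine (hP.dotProduct (smoothOn_deriv hx.isOpen ?_)).continuousOn
      exact hφJ.smul hG
    · exact ((smoothOn_deriv hx.isOpen hφJ).mul hM).continuousOn

end Noether

end SE3Variational

/-! ### Assembly of the variational, adjoint and conservation statements. -/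

theorem mainTheorem2 (n : ℕ) (L : Jets n → ℝ) (Ω : Set (Jets n)) (hΩ : IsOpen Ω)
    (hL : ContDiffOn ℝ ∞ L Ω)
    (J : Set ℝ) (hJ : IsOpen J) (hJc : J.OrdConnected)
    (x : ℝ → Fin 3 → ℝ) (hx : ContDiffOn ℝ ∞ x J)
    (harc : ∀ s ∈ J, speed x s = 1) (hpos : ∀ s ∈ J, 0 < curvature x s)
    (hjet : ∀ s ∈ J, jet n (curvature x) (torsion x) s ∈ Ω)
    (κ τ lam₀ : ℝ → ℝ) (hκ : κ = curvature x) (hτ : τ = torsion x)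
    (hlam₀ : lam₀ = multiplier L κ τ) :
    -- the invariantized Euler-Lagrange equations of the constrained problem
    (∀ μ : ℝ → ℝ, ContDiffOn ℝ ∞ μ J →
      ∀ lam : ℝ → ℝ, (lam = fun s => μ s + 2 * τ s * eulerτ L κ τ s) →
        (∀ c d : ℝ, c < d → Set.Icc c d ⊆ J →
          ∀ v : ℝ → Fin 3 → ℝ, ContDiff ℝ ∞ v → tsupport v ⊆ Set.Ioo c d →
            HasDerivAt
              (fun ε : ℝ => constrainedAction L μ c d (fun s => x s + ε • v s))
              (∫ s in c..d, (elX L κ τ lam s * (v s ⬝ᵥ tangent x s)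
                + elY L κ τ lam s * (v s ⬝ᵥ normal x s)
                + elZ L κ τ s * (v s ⬝ᵥ binormal x s))) 0) ∧
        (IsExtremal (constrainedAction L μ) J x ↔ SolvesEL L κ τ J lam)) ∧
    -- elimination of the multiplier
    (∀ lam : ℝ → ℝ, (DifferentiableOn ℝ lam J ∧ ∀ s ∈ J, elX L κ τ lam s = 0) ↔
      ∃ C : ℝ, ∀ s ∈ J, lam s = lam₀ s + C) ∧
    -- for the functional without constraint the constant is zero
    (IsExtremal (arcAction L) J x ↔ ∀ s ∈ J, elY L κ τ lam₀ s = 0 ∧ elZ L κ τ s = 0) ∧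
    -- the matrix is the adjoint representation at the frame
    (∀ s ∈ J, frenet x s ∈ Matrix.specialOrthogonalGroup (Fin 3) ℝ ∧
      ∀ (j : Fin 3 ⊕ Fin 3) (p : Fin 3 → ℝ),
        generator j (frenet x s *ᵥ p + x s) =
          frenet x s *ᵥ ∑ k, adFrame x s j k • generator k p) ∧
    -- its product with the vector of invariants consists of the six Noether currents
    (∀ μ : ℝ → ℝ, ContDiffOn ℝ ∞ μ J →
      ∀ lam : ℝ → ℝ, (lam = fun s => μ s + 2 * τ s * eulerτ L κ τ s) →
        ∀ c d : ℝ, c < d → Set.Icc c d ⊆ J →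
          ∀ φ : ℝ → ℝ, ContDiff ℝ ∞ φ → tsupport φ ⊆ Set.Ioo c d → ∀ j : Fin 3 ⊕ Fin 3,
            HasDerivAt
              (fun ε : ℝ =>
                constrainedAction L μ c d (fun s => x s + ε • φ s • generator j (x s)))
              (∫ s in c..d, deriv φ s * (adFrame x s *ᵥ upsilon L κ τ lam s) j) 0) ∧
    -- the conservation laws
    (∀ lam : ℝ → ℝ, SolvesEL L κ τ J lam →
      ∃ c₁ c₂ : Fin 3 → ℝ, ∀ s ∈ J,
        adFrame x s *ᵥ upsilon L κ τ lam s = Sum.elim c₁ c₂) ∧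
    ((∀ s ∈ J, elY L κ τ lam₀ s = 0 ∧ elZ L κ τ s = 0) →
      ∃ c₁ c₂ : Fin 3 → ℝ, ∀ s ∈ J,
        adFrame x s *ᵥ upsilon L κ τ lam₀ s = Sum.elim c₁ c₂) := by
  subst hκ hτ hlam₀
  have hF : IsFrenetCurve J x := ⟨hJ, hx, harc, hpos⟩
  have hR : IsRegularAlong L Ω J (curvature x) (torsion x) :=
    ⟨hΩ, hL, hJ, hF.smooth_curvature, hF.smooth_torsion, hjet⟩
  have hJp : IsPreconnected J := hJc.isPreconnected
  have hlam : ∀ μ : ℝ → ℝ, ContDiffOn ℝ ∞ μ J → ∀ lam : ℝ → ℝ,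
      (lam = fun s => μ s + 2 * torsion x s * eulerτ L (curvature x) (torsion x) s) →
      ContDiffOn ℝ ∞ lam J := by
    rintro μ hμ lam rfl
    exact hμ.add ((contDiffOn_const.mul hR.smooth_snd).mul hR.smooth_eulerτ)
  have hmul := hR.smooth_multiplier
  -- The tangential equation holds identically for λ₀, so only the normal and binormal ones are
  -- conditions on the curve.
  have hEL₀ : (∀ s ∈ J, elY L (curvature x) (torsion x)
        (multiplier L (curvature x) (torsion x)) s = 0 ∧ elZ L (curvature x) (torsion x) s = 0) ↔
      SolvesEL L (curvature x) (torsion x) J (multiplier L (curvature x) (torsion x)) :=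
    ⟨fun h => ⟨hmul.differentiableOn (by simp), fun s hs => ⟨hR.elX_multiplier hs, h s hs⟩⟩,
      fun h s hs => (h.2 s hs).2⟩
  refine ⟨fun μ hμ lam hl => ⟨fun c d hcd hsub v hv hsupp => ?_, ?_⟩,
    hR.elX_eq_zero_iff hJp, ?_, fun s hs => ⟨hF.frenet_mem hs, hF.generator_frenet hs⟩,
    fun μ hμ lam hl c d hcd hsub φ hφ hsupp j => ?_,
    fun lam h => exists_adFrame_mulVec_upsilon_eq hF hR hJp h,
    fun h => exists_adFrame_mulVec_upsilon_eq hF hR hJp (hEL₀.1 h)⟩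
  · have hls := hlam μ hμ lam hl
    refine (hasDerivAt_constrainedAction hF hR hv hcd.le hsub hsupp hμ hl).congr_deriv ?_
    rw [integral_momentum_dotProduct hF hR hls hcd.le hsub hv hsupp]
    refine intervalIntegral.integral_congr fun s hs => ?_
    rw [Set.uIcc_of_le hcd.le] at hs
    exact neg_deriv_momentum_dotProduct hF hR (hsub hs)
      (hasDerivAt_of_smoothOn hJ hls (hsub hs)).differentiableAt (v s)
  · exact isExtremal_iff hF hR (hlam μ hμ lam hl) fun c d hcd hsub v hv hsupp =>
      hasDerivAt_constrainedAction hF hR hv hcd.le hsub hsupp hμ hl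
  · rw [hEL₀]
    exact isExtremal_iff hF hR hmul fun c d hcd hsub v hv hsupp =>
      hasDerivAt_arcAction hF hR hv hcd.le hsub hsupp
  · have hsuppJ : tsupport φ ⊆ J := (hsupp.trans Set.Ioo_subset_Icc_self).trans hsub
    have hv := contDiff_smul_of_tsupport_subset hJ hφ hsuppJ (smoothOn_generator hx j)
    have hvsupp : tsupport (fun s => φ s • generator j (x s)) ⊆ Set.Ioo c d :=
      (closure_mono (Function.support_smul_subset_left φ _)).trans hsupp
    rw [← integral_momentum_generator hF hR (hlam μ hμ lam hl) hcd.le hsub hφ hsupp j]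
    exact hasDerivAt_constrainedAction hF hR hv hcd.le hsub hvsupp hμ hl
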